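/- Let $A[1..n]$ be an array over a totally ordered set that consists of $r$ runs of lengths $L_1,\dots,L_r\ge 1$ with $L_1+\dots+L_r=n$: consecutive segments, each weakly increasing or strictly decreasing, such that no run stays weakly increasing when the first element of the next run is appended. (The maximal weakly increasing segments are an example, and so are the runs obtained by repeatedly splitting off from the left a longest weakly increasing or strictly decreasing segment.) Let $\mathcal H=\sum_{i=1}^r \frac{L_i}{n}\log_2\frac{n}{L_i}$. PeekSort is the following recursive procedure, started as $\mathrm{PeekSort}(A[1..n],1,n)$. In $\mathrm{PeekSort}(A[\ell..r'],e,s)$ the prefix $A[\ell..e]$ and the suffix $A[s..r']$ are already sorted. If $e=r'$ or $s=\ell$, return. Let $m=\ell+\lfloor (r'-\ell)/2\rfloor$. - If $m\le e$: call $\mathrm{PeekSort}(A[e+1..r'],e+1,s)$ and merge $A[\ell..e]$ with $A[e+1..r']$. - Otherwise, if $m\ge s$: call $\mathrm{PeekSort}(A[\ell..s-1],e,s-1)$ and merge $A[\ell..s-1]$ with $A[s..r']$. - Otherwise, find the run $A[i..j]$ containing position $m$ by scanning left from $m$ (not beyond $\ell$) and right from $m$ (not beyond $r'$), at a cost of at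 most one comparison per pair of neighbours tested, and reverse it if it is decreasing. If $i=\ell$ and $j=r'$, return. If $m-i<j-m$, call $\mathrm{PeekSort}(A[\ell..i-1],e,i-1)$ and $\mathrm{PeekSort}(A[i..r'],j,s)$ and merge $A[\ell..i-1]$ with $A[i..r']$. Otherwise call $\mathrm{PeekSort}(A[\ell..j],e,i)$ and $\mathrm{PeekSort}(A[j+1..r'],j+1,s)$ and merge $A[\ell..j]$ with $A[j+1..r']$. The merges are standard stable two-way merges that compare the two front elements until one side is exhausted. The merge cost of a merge is the size of its result, and the merge cost of a merging procedure is the sum over all its merges. 1. If $n\ge 3$ or $r\ge 2$, the merge cost of PeekSort on $A$ is at most $\mathcal H n+2n-(r+2)$. 2. If $n\ge 2$, the number of comparisons made by PeekSort on $A$ is at most $\mathcal H n+3n-(2r+3)$. 3. Both bounds are optimal up to $O(n)$ terms in the worst case: - For all run lengths $L_1,\dots,L_r\ge1$ with sum $n$, every way to merge the runs into one by binary merges has merge cost at least $\mathcal H n$. - There is an absolute constant $C$ such that for all $L_1,\dots,L_r\ge 1$ with sum $n$, every comparison-based algorithm that sorts all arrays of $n$ distinct elements made up of consecutive increasing segments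 of lengths $L_1,\dots,L_r$ needs at least $\mathcal H n-Cn$ comparisons on one of these arrays. If $L_i\ge 2$ for all $i<r$, the same holds with the arrays restricted to those whose maximal increasing segments have exactly the lengths $L_1,\dots,L_r$, for every algorithm that sorts these arrays. -/

import Mathlib

/-! ### Comparison-based computations -/

/-- A computation that accesses the elements of its input array (indexed by `ι`) only through
comparisons, i.e. a comparison tree: `ask x y k` compares the elements at `x` and `y` and
continues with `k true` if (element at `x`) `≤` (element at `y`), and with `k false` otherwise. -/
inductive CompTree (ι β : Type) : Type where
  | ret (b : β) : CompTree ι β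
  | ask (x y : ι) (k : Bool → CompTree ι β) : CompTree ι β

namespace CompTree

/-- Sequential composition. -/
def bind {ι β γ : Type} : CompTree ι β → (β → CompTree ι γ) → CompTree ι γ
  | ret b, f => f b
  | ask x y k, f => ask x y (fun c => bind (k c) f)

instance {ι : Type} : Monad (CompTree ι) where
  pure := ret
  bind := bind

/-- The result of a computation on the input `A`. -/
def run {ι β : Type} {α : Type*} [LinearOrder α] (A : ι → α) : CompTree ι β → β
  | ret b => b
  | ask x y k => run A (k (decide (A x ≤ A y)))

/-- The number of comparisons that a computation performs on the input `A`. -/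
def cost {ι β : Type} {α : Type*} [LinearOrder α] (A : ι → α) : CompTree ι β → ℕ
  | ret _ => 0
  | ask x y k => 1 + cost A (k (decide (A x ≤ A y)))

end CompTree

/-! ### Runs -/

/-- `A` is weakly increasing on the positions `a, …, b - 1`. -/
def IncreasingOn {α : Type*} [LinearOrder α] {n : ℕ} (A : Fin n → α) (a b : ℕ) : Prop :=
  ∀ x y : Fin n, a ≤ (x : ℕ) → x < y → (y : ℕ) < b → A x ≤ A y

/-- `A` is strictly decreasing on the positions `a, …, b - 1`. -/
def StrictDecreasingOn {α : Type*} [LinearOrder α] {n : ℕ} (A : Fin n → α) (a b : ℕ) : Prop :=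
  ∀ x y : Fin n, a ≤ (x : ℕ) → x < y → (y : ℕ) < b → A y < A x

/-- The position at which the `i`th segment starts (counting from `0`), when the array is cut into
consecutive segments of lengths `L`. -/
def segStart (L : List ℕ) (i : ℕ) : ℕ := (L.take i).sum

/-- The array `A` is cut into nonempty consecutive segments of lengths `L`, each of them weakly
increasing. -/
structure IncreasingSegments {α : Type*} [LinearOrder α] {n : ℕ}
    (A : Fin n → α) (L : List ℕ) : Prop where
  pos : ∀ l ∈ L, 0 < l
  sum : L.sum = n
  incr : ∀ i < L.length, IncreasingOn A (segStart L i) (segStart L (i + 1))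

/-- The array `A` consists of runs of lengths `L`: it is cut into nonempty consecutive segments of
lengths `L`, each of them weakly increasing or strictly decreasing, and no run remains weakly
increasing when it is extended by the first element of the next run.

The maximal weakly increasing regions of `A` are such a decomposition, and so are the runs that one
gets by repeatedly splitting off from the left a longest region that is weakly increasing or
strictly decreasing. -/
structure IsRunDecomposition {α : Type*} [LinearOrder α] {n : ℕ}
    (A : Fin n → α) (L : List ℕ) : Prop where
  pos : ∀ l ∈ L, 0 < l
  sum : L.sum = n
  mono : ∀ i < L.length, IncreasingOn A (segStart L i) (segStart L (i + 1)) ∨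
    StrictDecreasingOn A (segStart L i) (segStart L (i + 1))
  maximal : ∀ i, i + 1 < L.length → ¬ IncreasingOn A (segStart L i) (segStart L (i + 1) + 1)

/-- The outcome of one step of a scan, from a position to the next one: the run stops, or it
continues and is increasing, or it continues and is decreasing. -/
inductive ScanStep : Type where
  | halt
  | up
  | down

/-- `test` is a way to find the runs of `A`, of lengths `L`, by sequential scans: `test k` decides,
by at most one comparison, whether the run that contains position `k` continues to position `k + 1`,
and, if so, in which direction. -/
structure DetectsRuns {α : Type*} [LinearOrder α] {n : ℕ} (A : Fin n → α) (L : List ℕ)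
    (test : ℕ → CompTree (Fin n) ScanStep) : Prop where
  cost_le : ∀ k, k + 1 < n → (test k).cost A ≤ 1
  halt_iff : ∀ k, k + 1 < n → ((test k).run A = ScanStep.halt ↔ ∃ i, k + 1 = segStart L i)
  up : ∀ x y : Fin n, (x : ℕ) + 1 = y → (test x).run A = ScanStep.up → A x ≤ A y
  down : ∀ x y : Fin n, (x : ℕ) + 1 = y → (test x).run A = ScanStep.down → A y < A x

/-- The usual test for maximal weakly increasing runs: compare the two neighbours. -/
def weaklyIncreasingTest (n : ℕ) (k : ℕ) : CompTree (Fin n) ScanStep :=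
  if h : k + 1 < n then
    CompTree.ask ⟨k, Nat.lt_of_succ_lt h⟩ ⟨k + 1, h⟩
      (fun c => CompTree.ret (if c then ScanStep.up else ScanStep.halt))
  else CompTree.ret ScanStep.halt

/-- The usual test finds the maximal weakly increasing runs. -/
theorem detectsRuns_weaklyIncreasingTest {α : Type*} [LinearOrder α] {n : ℕ} {A : Fin n → α}
    {L : List ℕ} (h : IncreasingSegments A L) (h' : IsRunDecomposition A L) :
    DetectsRuns A L (weaklyIncreasingTest n) := by
  have key : ∀ k (hk : k + 1 < n), (weaklyIncreasingTest n k).run A =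
      if A ⟨k, Nat.lt_of_succ_lt hk⟩ ≤ A ⟨k + 1, hk⟩ then ScanStep.up else ScanStep.halt := by
    intro k hk
    simp [weaklyIncreasingTest, hk, CompTree.run]
  have hn : segStart L L.length = n := by simp [segStart, h.sum]
  have hge : ∀ i, L.length ≤ i → segStart L i = n := by
    intro i hi
    simp [segStart, List.take_of_length_le hi, h.sum]
  refine ⟨?_, ?_, ?_, ?_⟩
  · intro k hk
    simp [weaklyIncreasingTest, hk, CompTree.cost]
  · intro k hk
    rw [key k hk]
    constructor
    · intro hs
      have hlt : ¬ A ⟨k, Nat.lt_of_succ_lt hk⟩ ≤ A ⟨k + 1, hk⟩ := by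
        intro hle
        simp [hle] at hs
      have hex : ∃ i, k < segStart L i := ⟨L.length, by omega⟩
      classical
      obtain ⟨i, hi⟩ : ∃ i, i = Nat.find hex := ⟨_, rfl⟩
      have h1 : k < segStart L i := hi ▸ Nat.find_spec hex
      have hmin : ∀ j < i, segStart L j ≤ k := fun j hj => by
        have := Nat.find_min hex (hi ▸ hj)
        omega
      rcases i with _ | i
      · simp [segStart] at h1
      · have h2 := hmin i (Nat.lt_succ_self i)
        have hiL : i < L.length := by
          by_contra hc
          have := hge i (by omega)
          omega
        refine ⟨i + 1, ?_⟩
        by_contra hne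
        exact hlt (h.incr i hiL ⟨k, _⟩ ⟨k + 1, hk⟩ h2 (by simp) (by simp only; omega))
    · rintro ⟨i, hi⟩
      rcases i with _ | i
      · simp [segStart] at hi
      · have hiL : i + 1 < L.length := by
          by_contra hc
          have := hge (i + 1) (by omega)
          omega
        have hmax := h'.maximal i hiL
        rw [if_neg]
        intro hle
        refine hmax fun x y hx hxy hy => ?_
        by_cases hyk : (y : ℕ) < segStart L (i + 1)
        · exact h.incr i (by omega) x y hx hxy hyk
        · have hy' : y = ⟨k + 1, hk⟩ := Fin.ext (by simp only; omega)
          have hxk : (x : ℕ) ≤ k := by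
            have : (x : ℕ) < y := hxy
            rw [hy'] at this
            simp only at this
            omega
          rw [hy']
          refine le_trans ?_ hle
          rcases Nat.lt_or_ge x k with hlt | hge'
          · exact h.incr i (by omega) x ⟨k, _⟩ hx hlt (by simp only; omega)
          · exact le_of_eq (congrArg A (Fin.ext (by simp only; omega)))
  · intro x y hxy hup
    have hk : (x : ℕ) + 1 < n := by omega
    rw [key x hk] at hup
    have hy : y = ⟨x + 1, hk⟩ := Fin.ext hxy.symm
    rw [hy]
    by_contra hc
    rw [if_neg hc] at hup
    cases hup
  · intro x y hxy hdown
    have hk : (x : ℕ) + 1 < n := by omega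
    rw [key x hk] at hdown
    split_ifs at hdown

/-! ### PeekSort -/

/-- The standard merge of two sorted sequences: the smaller one of the two front elements (the left
one, if they are equal) is output, until one of the two sequences is exhausted. -/
def mergeLists {ι : Type} : List ι → List ι → CompTree ι (List ι)
  | [], ys => CompTree.ret ys
  | x :: xs, [] => CompTree.ret (x :: xs)
  | x :: xs, y :: ys => CompTree.ask x y (fun c =>
      if c then (mergeLists xs (y :: ys)).bind (fun zs => CompTree.ret (x :: zs))
      else (mergeLists (x :: xs) ys).bind (fun zs => CompTree.ret (y :: zs)))
termination_by xs ys => xs.length + ys.length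

/-- Merges two sorted pieces, given with the merge costs spent on them so far; the merge itself
has merge cost (size of the result). -/
def mergeStep {ι : Type} (p q : List ι × ℕ) : CompTree ι (List ι × ℕ) := do
  let zs ← mergeLists p.1 q.1
  return (zs, p.2 + q.2 + (p.1.length + q.1.length))

/-- `A[a..b]` (both ends included). -/
def slice {ι : Type} (arr : List ι) (a b : ℕ) : List ι := (arr.drop a).take (b + 1 - a)

/-- The array after reversing `A[a..b]` in place. -/
def reverseSlice {ι : Type} (arr : List ι) (a b : ℕ) : List ι :=
  arr.take a ++ (slice arr a b).reverse ++ arr.drop (b + 1)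

/-- Scans left from a position as long as the run continues, but not beyond `l`. Returns the
position where it ends and whether it went along a decreasing run. -/
def extendRunLeft {ι : Type} (test : ℕ → CompTree ι ScanStep) (l : ℕ) : ℕ → CompTree ι (ℕ × Bool)
  | 0 => return (0, false)
  | i + 1 =>
    if i + 1 ≤ l then return (i + 1, false)
    else do
      match ← test i with
      | ScanStep.halt => return (i + 1, false)
      | ScanStep.up => extendRunLeft test l i
      | ScanStep.down => do
        let p ← extendRunLeft test l i
        return (p.1, true)

/-- Scans right from the position `j` as long as the run continues, for at most the given number of
steps. Returns the position where it ends and whether it went along a decreasing run. -/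
def extendRunRight {ι : Type} (test : ℕ → CompTree ι ScanStep) :
    ℕ → ℕ → CompTree ι (ℕ × Bool)
  | 0, j => return (j, false)
  | steps + 1, j => do
      match ← test j with
      | ScanStep.halt => return (j, false)
      | ScanStep.up => extendRunRight test steps (j + 1)
      | ScanStep.down => do
        let p ← extendRunRight test steps (j + 1)
        return (p.1, true)

/-- `PeekSort(A[l..r], e, s)`, where `A[l..e]` and `A[s..r]` are already sorted. Returns the sorted
range and the merge cost. The array `arr` lists the input indices of its entries; only the
entries in `A[l..r]` are used. A decreasing run is reversed as soon as it is found.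

The first argument bounds the depth of the recursion. It is immaterial as long as it is at least
`r - l + 1`, since the ranges of the recursive calls are nonempty and strictly smaller. -/
def peekSortAux {ι : Type} (test : ℕ → CompTree ι ScanStep) :
    ℕ → List ι → ℕ → ℕ → ℕ → ℕ → CompTree ι (List ι × ℕ)
  | 0, _, _, _, _, _ => return ([], 0)
  | depth + 1, arr, l, r, e, s =>
    if e = r ∨ s = l then return (slice arr l r, 0)
    else
      let m := l + (r - l) / 2
      if m ≤ e then do
        let q ← peekSortAux test depth arr (e + 1) r (e + 1) s
        mergeStep (slice arr l e, 0) q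
      else if s ≤ m then do
        let p ← peekSortAux test depth arr l (s - 1) e (s - 1)
        mergeStep p (slice arr s r, 0)
      else do
        let (i, revLeft) ← extendRunLeft test l m
        let (j, revRight) ← extendRunRight test (r - m) m
        let arr' := if revLeft || revRight then reverseSlice arr i j else arr
        if i = l ∧ j = r then return (slice arr' l r, 0)
        else if m - i < j - m then do
          let p ← peekSortAux test depth arr' l (i - 1) e (i - 1)
          let q ← peekSortAux test depth arr' i r j s
          mergeStep p q
        else do
          let p ← peekSortAux test depth arr' l j e i
          let q ← peekSortAux test depth arr' (j + 1) r (j + 1) s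
          mergeStep p q

/-- PeekSort on an array of `n` elements (at the positions `0, …, n - 1`), with the given method to
scan for runs. Returns the input indices in sorted order and the total merge cost. -/
def peekSort (n : ℕ) (test : ℕ → CompTree (Fin n) ScanStep) :
    CompTree (Fin n) (List (Fin n) × ℕ) :=
  peekSortAux test n (List.finRange n) 0 (n - 1) 0 (n - 1)

/-! ### Entropy, merge trees, sorting algorithms -/

/-- The binary Shannon entropy. -/
noncomputable def shannonEntropy (p : List ℝ) : ℝ := (p.map fun x => x * Real.logb 2 (1 / x)).sum

/-- `ℋ(L₁/n, …, L_r/n)` with `n = L₁ + ⋯ + L_r`. -/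
noncomputable def runEntropy (L : List ℕ) : ℝ :=
  shannonEntropy (L.map fun l => (l : ℝ) / (L.sum : ℝ))

/-- An order of binary merges: the leaves are the runs, given by their lengths; an inner node is the
merge of the results of its two children. -/
inductive MergeTree : Type where
  | leaf (len : ℕ) : MergeTree
  | node (left right : MergeTree) : MergeTree

namespace MergeTree

/-- The lengths of the runs that are merged. -/
def leaves : MergeTree → List ℕ
  | leaf len => [len]
  | node t u => leaves t ++ leaves u

/-- The size of the final result. -/
def size : MergeTree → ℕ
  | leaf len => len
  | node t u => size t + size u

/-- The merge cost: the sum of the sizes of all results of merges. -/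
def mergeCost : MergeTree → ℕ
  | leaf _ => 0
  | node t u => mergeCost t + mergeCost u + (size t + size u)

end MergeTree

/-- The comparison tree `T` sorts the input `A`: it returns the indices in an order in which the
entries are weakly increasing. -/
def SortsInput {n : ℕ} (T : CompTree (Fin n) (List (Fin n))) (A : Fin n → ℕ) : Prop :=
  (T.run A).Perm (List.finRange n) ∧ ((T.run A).map A).Pairwise (· ≤ ·)

/-! ### Costs of composed computations, merges and scans -/

namespace CompTree

variable {ι β γ : Type} {α : Type*} [LinearOrder α] (A : ι → α)

/-! Write f(x) = x log₂ x (`mulLogb`) and let W be the sum of f over the run lengths. Then ℋn = f(n)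
- W, so entropy bounds become statements about how f changes when two ranges are joined.

Upper bounds. `rangeBound` establishes `CostBound` for every recursive call, by induction on the
depth. Suppose a range is cut into parts of sizes N ≤ M. Since f(N + M) ≥ f(N) + f(M) + 2N
(`mulLogb_add_ge`), the entropy pays for 2N of the merge cost N + M. The remaining M - N is at most
the length L of the run at the midpoint, because the cut is made at the end of that run that is
closer to the midpoint. This run lies in the larger part, whose call knows it as a sorted prefix or
suffix and is therefore cheaper; the terms `a` and `b` in `CostBound` record this saving of L - 1.
For comparisons the terms are doubled: the second copy pays for the roughly L tests that find the
run. A known run that reaches the midpoint is split off without a search. These two cases are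
`CostBound.append` and `CostBound.cons`. The only configuration in which the additive constants do
not work out is a range of three runs of length one, which is computed exactly in
`rangeBound_three`.

Lower bounds. For merge trees, f(a + b) ≤ f(a) + f(b) + (a + b), and one sums over the inner nodes.
For sorting, c comparisons distinguish at most 2^c inputs, so it suffices to count the permutations
that increase on all segments. Sorting an arbitrary permutation segment by segment shows that n! is
at most their number times ∏ Lᵢ^Lᵢ; with n! ≥ (n/e)^n this gives ℋn - n log₂ e. Requiring a descent
at every boundary loses at most a factor 2^n (`card_sortedPerms_le`): wherever a boundary is an
ascent, exchange its two entries. -/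

theorem run_bind (T : CompTree ι β) (f : β → CompTree ι γ) :
    (T >>= f).run A = (f (T.run A)).run A := by
  change (T.bind f).run A = _
  induction T with
  | ret b => rfl
  | ask x y k ih => exact ih _

theorem cost_bind (T : CompTree ι β) (f : β → CompTree ι γ) :
    (T >>= f).cost A = T.cost A + (f (T.run A)).cost A := by
  change (T.bind f).cost A = _
  induction T with
  | ret b => simp [bind, cost, run]
  | ask x y k ih => simp only [bind, cost, run, ih]; omega

theorem run_pure (b : β) : (pure b : CompTree ι β).run A = b := rfl

theorem cost_pure (b : β) : (pure b : CompTree ι β).cost A = 0 := rfl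

end CompTree

open CompTree

section

variable {ι : Type} {α : Type*} [LinearOrder α] (A : ι → α)

theorem length_mergeLists (xs ys : List ι) :
    ((mergeLists xs ys).run A).length = xs.length + ys.length := by
  fun_induction mergeLists xs ys with
  | case1 ys => simp [run]
  | case2 x xs => simp [run]
  | case3 x xs y ys ih1 ih2 =>
    simp only [run]
    split_ifs
    · have := run_bind A (mergeLists xs (y :: ys)) (fun zs => ret (x :: zs))
      simp only [Bind.bind] at this
      rw [this]
      simp [run, ih1]; omega
    · have := run_bind A (mergeLists (x :: xs) ys) (fun zs => ret (y :: zs))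
      simp only [Bind.bind] at this
      rw [this]
      simp [run, ih2]; omega

theorem cost_mergeLists_le (xs ys : List ι) :
    (mergeLists xs ys).cost A ≤ xs.length + ys.length - 1 := by
  fun_induction mergeLists xs ys with
  | case1 ys => simp [cost]
  | case2 x xs => simp [cost]
  | case3 x xs y ys ih1 ih2 =>
    simp only [cost]
    split_ifs
    · have := cost_bind A (mergeLists xs (y :: ys)) (fun zs => ret (x :: zs))
      simp only [Bind.bind] at this
      rw [this]
      simp [cost] at *; omega
    · have := cost_bind A (mergeLists (x :: xs) ys) (fun zs => ret (y :: zs))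
      simp only [Bind.bind] at this
      rw [this]
      simp [cost] at *; omega

/-- The right side is exhausted after the first comparison, whatever the length of the left side.
This beats `cost_mergeLists_le`, which is too weak for three runs of length one. -/
theorem cost_mergeLists_singleton_of_lt (x : ι) (xs : List ι) {z : ι} (h : A z < A x) :
    (mergeLists (x :: xs) [z]).cost A = 1 := by
  rw [mergeLists]
  simp [cost, not_le.2 h, mergeLists, CompTree.bind]

theorem run_mergeLists_singleton_of_lt {x z : ι} (h : A z < A x) :
    (mergeLists [x] [z]).run A = [z, x] := by
  rw [mergeLists]
  simp [run, not_le.2 h, mergeLists, CompTree.bind]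

theorem run_mergeStep (p q : List ι × ℕ) :
    (mergeStep p q).run A =
      ((mergeLists p.1 q.1).run A, p.2 + q.2 + (p.1.length + q.1.length)) := by
  simp [mergeStep, run_bind, run_pure]

theorem cost_mergeStep (p q : List ι × ℕ) :
    (mergeStep p q).cost A = (mergeLists p.1 q.1).cost A := by
  simp [mergeStep, cost_bind, cost_pure]

theorem length_slice {arr : List ι} {a b : ℕ} (hb : b < arr.length) :
    (slice arr a b).length = b + 1 - a := by
  simp [slice]; omega

theorem length_reverseSlice {arr : List ι} {a b : ℕ} (hab : a ≤ b) (hb : b < arr.length) :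
    (reverseSlice arr a b).length = arr.length := by
  simp [reverseSlice, length_slice hb]; omega

theorem reverseSlice_self (arr : List ι) (a : ℕ) : reverseSlice arr a a = arr := by
  have h : (slice arr a a).reverse = slice arr a a := by
    rw [slice, Nat.add_sub_cancel_left]
    rcases arr.drop a with _ | ⟨x, xs⟩ <;> simp
  rw [reverseSlice, h, slice, Nat.add_sub_cancel_left, ← List.take_add, List.take_append_drop]

theorem getElem?_reverseSlice {arr : List ι} {a b k : ℕ} (hab : a ≤ b) (hb : b < arr.length)
    (hk : k < a ∨ b < k) : (reverseSlice arr a b)[k]? = arr[k]? := by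
  have h1 : (arr.take a).length = a := by simp; omega
  have h2 := length_slice (a := a) hb
  rcases hk with hk | hk
  · rw [reverseSlice, List.append_assoc, List.getElem?_append_left (by omega),
      List.getElem?_take_of_lt hk]
  · rw [reverseSlice, List.getElem?_append_right (by simp [h2]; omega)]
    simp only [List.length_append, h1, List.length_reverse, h2, List.getElem?_drop]
    congr 1
    omega

end

/-! ### Positions of runs -/

section

variable {L : List ℕ}

theorem segStart_zero : segStart L 0 = 0 := rfl

theorem segStart_length : segStart L L.length = L.sum := by simp [segStart]

theorem segStart_of_length_le {i : ℕ} (hi : L.length ≤ i) : segStart L i = L.sum := by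
  simp [segStart, List.take_of_length_le hi]

theorem segStart_succ {i : ℕ} (hi : i < L.length) :
    segStart L (i + 1) = segStart L i + L[i] := by
  exact List.sum_take_succ L i hi

theorem segStart_mono (L : List ℕ) : Monotone (segStart L) := by
  refine monotone_nat_of_le_succ fun i => ?_
  rcases Nat.lt_or_ge i L.length with hi | hi
  · rw [segStart_succ hi]; omega
  · rw [segStart_of_length_le hi, segStart_of_length_le (by omega)]

theorem segStart_lt_succ (hpos : ∀ l ∈ L, 0 < l) {i : ℕ} (hi : i < L.length) : segStart L i < segStart L (i + 1) := by
  have := hpos _ (List.getElem_mem hi)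
  rw [segStart_succ hi]; omega

theorem segStart_lt (hpos : ∀ l ∈ L, 0 < l) {i j : ℕ} (hij : i < j) (hj : j ≤ L.length) :
    segStart L i < segStart L j :=
  (segStart_lt_succ hpos (by omega)).trans_le (segStart_mono L hij)

theorem segStart_add_le (hpos : ∀ l ∈ L, 0 < l) {i j : ℕ} (hij : i ≤ j) (hj : j ≤ L.length) :
    segStart L i + (j - i) ≤ segStart L j := by
  induction j, hij using Nat.le_induction with
  | base => simp
  | succ j h ih =>
    have := segStart_lt_succ hpos (i := j) (by omega)
    have := ih (by omega)
    omega

theorem exists_segStart_le_lt {p q m : ℕ} (h1 : segStart L p ≤ m) (h2 : m < segStart L q) :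
    ∃ t, p ≤ t ∧ t < q ∧ segStart L t ≤ m ∧ m < segStart L (t + 1) := by
  induction q with
  | zero => simp [segStart] at h2
  | succ q ih =>
    rcases Nat.lt_or_ge m (segStart L q) with h | h
    · obtain ⟨t, h3, h4, h5⟩ := ih h
      exact ⟨t, h3, by omega, h5⟩
    · refine ⟨q, ?_, by omega, h, h2⟩
      by_contra hc
      have := segStart_mono L (show q + 1 ≤ p by omega)
      omega

theorem not_segStart_of_between {t x : ℕ} (h1 : segStart L t < x) (h2 : x < segStart L (t + 1)) :
    ¬ ∃ i, x = segStart L i := by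
  rintro ⟨i, rfl⟩
  rcases Nat.lt_or_ge t i with h | h
  · have := segStart_mono L (show t + 1 ≤ i from h); omega
  · have := segStart_mono L h; omega

end

/-! ### Scanning for runs -/

section

variable {α : Type*} [LinearOrder α] {n : ℕ} {A : Fin n → α} {L : List ℕ}
  {test : ℕ → CompTree (Fin n) ScanStep}

/-- Each step inside the run costs one test. Noticing the end costs one more, except when the run
begins at the left end of the range, where the scan stops without testing. This free stop is needed
later, when the larger part of a split is a single run. -/
theorem DetectsRuns.extendRunLeft (ht : DetectsRuns A L test) {p t : ℕ} (hpt : p ≤ t) (x : ℕ)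
    (h1 : segStart L t ≤ x) (h2 : x < segStart L (t + 1)) (hx : x < n) :
    ((extendRunLeft test (segStart L p) x).run A).1 = segStart L t ∧
    (extendRunLeft test (segStart L p) x).cost A ≤
      x - segStart L t + if segStart L p < segStart L t then 1 else 0 := by
  have hl := segStart_mono L hpt
  induction x with
  | zero => simp [_root_.extendRunLeft, run_pure, cost_pure]; omega
  | succ x ih =>
    rw [_root_.extendRunLeft]
    split_ifs with hc hlt hlt
    · omega
    · exact ⟨by simp only [run_pure]; omega, by simp [cost_pure]⟩
    all_goals
      have hcost := ht.cost_le x hx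
      have hh := ht.halt_iff x hx
      simp only [run_bind, cost_bind]
      rcases Nat.lt_or_ge x (segStart L t) with hxt | hxt
      · have : x + 1 = segStart L t := by omega
        rw [hh.2 ⟨t, this⟩]
        simp only [run_pure, cost_pure]
        omega
      · have hnh := mt hh.1 (not_segStart_of_between (t := t) (by omega) h2)
        obtain ⟨ih1, ih2⟩ := ih hxt (by omega) (by omega)
        first | rw [if_pos hlt] at ih2 | rw [if_neg hlt] at ih2
        rcases h : (test x).run A with _ | _ | _
        · exact absurd h hnh
        · exact ⟨ih1, by simp only; omega⟩
        · simp only [run_bind, cost_bind, run_pure, cost_pure]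
          exact ⟨ih1, by omega⟩

theorem DetectsRuns.extendRunRight (ht : DetectsRuns A L test) {t r : ℕ}
    (htr : segStart L (t + 1) ≤ r + 1) (hr : r < n) (steps x : ℕ) (hs : x + steps = r)
    (h1 : segStart L t ≤ x) (h2 : x < segStart L (t + 1)) :
    ((extendRunRight test steps x).run A).1 + 1 = segStart L (t + 1) ∧
    (extendRunRight test steps x).cost A ≤
      segStart L (t + 1) - 1 - x + if segStart L (t + 1) < r + 1 then 1 else 0 := by
  induction steps generalizing x with
  | zero => simp [_root_.extendRunRight, run_pure, cost_pure]; omega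
  | succ steps ih =>
    have hcost := ht.cost_le x (by omega)
    have hh := ht.halt_iff x (by omega)
    rw [_root_.extendRunRight]
    simp only [run_bind, cost_bind]
    rcases Nat.lt_or_ge (x + 1) (segStart L (t + 1)) with hxt | hxt
    · have hnh := mt hh.1 (not_segStart_of_between (t := t) (by omega) hxt)
      obtain ⟨ih1, ih2⟩ := ih (x + 1) (by omega) (by omega) hxt
      rcases h : (test x).run A with _ | _ | _
      · exact absurd h hnh
      · exact ⟨ih1, by simp only; omega⟩
      · simp only [run_bind, cost_bind, run_pure, cost_pure]
        exact ⟨ih1, by omega⟩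
    · have : x + 1 = segStart L (t + 1) := by omega
      rw [hh.2 ⟨t + 1, this⟩, if_pos (by omega)]
      simp only [run_pure, cost_pure]
      omega

end

/-! ### The function `x log₂ x` -/

/-- The function `x log₂ x`. -/
noncomputable def mulLogb (x : ℝ) : ℝ := x * Real.logb 2 x

theorem mulLogb_one : mulLogb 1 = 0 := by simp [mulLogb]

theorem le_logb_one_add {x : ℝ} (h0 : 0 ≤ x) (h1 : x ≤ 1) : x ≤ Real.logb 2 (1 + x) := by
  rw [Real.le_logb_iff_rpow_le one_lt_two (by linarith)]
  -- Bernoulli's inequality for exponents in `[0, 1]`, here `2 ^ x ≤ 1 + x`.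
  have := rpow_one_add_le_one_add_mul_self (s := 1) (by norm_num) h0 h1
  norm_num at this
  linarith

theorem mulLogb_add_sub {a b : ℝ} (ha : 0 < a) (hb : 0 < b) :
    mulLogb (a + b) - mulLogb a - mulLogb b =
      a * Real.logb 2 (1 + b / a) + b * Real.logb 2 (1 + a / b) := by
  have h1 : 1 + b / a = (a + b) / a := by field_simp
  have h2 : 1 + a / b = (a + b) / b := by field_simp; ring
  rw [h1, h2, Real.logb_div (by positivity) ha.ne', Real.logb_div (by positivity) hb.ne']
  unfold mulLogb
  ring

/-- The binary entropy function satisfies `h x ≥ 2 x` for `x ≤ 1 / 2`. -/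
theorem mulLogb_add_ge {a b : ℝ} (hb : 0 < b) (hba : b ≤ a) :
    mulLogb a + mulLogb b + 2 * b ≤ mulLogb (a + b) := by
  have ha : 0 < a := hb.trans_le hba
  have h := mulLogb_add_sub ha hb
  have h1 : b / a ≤ Real.logb 2 (1 + b / a) :=
    le_logb_one_add (by positivity) ((div_le_one ha).2 hba)
  have h2 : 1 ≤ Real.logb 2 (1 + a / b) := by
    rw [Real.le_logb_iff_rpow_le one_lt_two (by positivity), Real.rpow_one]
    have : 1 ≤ a / b := (one_le_div hb).2 hba
    linarith
  have h3 : b ≤ a * Real.logb 2 (1 + b / a) := by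
    have := mul_le_mul_of_nonneg_left h1 ha.le
    rwa [mul_div_cancel₀ _ ha.ne'] at this
  have h4 : b ≤ b * Real.logb 2 (1 + a / b) := le_mul_of_one_le_right hb.le h2
  linarith

/-- For `a ≥ 3` the added element alone contributes `log₂ (1 + a) ≥ 2`. The gain of one over
`mulLogb_add_ge` is needed when a single element is split off. -/
theorem mulLogb_add_one_ge {a : ℝ} (ha : 3 ≤ a) : mulLogb a + 3 ≤ mulLogb (a + 1) := by
  have h := mulLogb_add_sub (a := a) (b := 1) (by linarith) one_pos
  have h1 : 1 / a ≤ Real.logb 2 (1 + 1 / a) :=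
    le_logb_one_add (by positivity) ((div_le_one (by linarith)).2 (by linarith))
  have h2 : 2 ≤ Real.logb 2 (1 + a / 1) := by
    rw [Real.le_logb_iff_rpow_le one_lt_two (by positivity)]
    norm_num
    linarith
  have h3 : 1 ≤ a * Real.logb 2 (1 + 1 / a) := by
    have := mul_le_mul_of_nonneg_left h1 (by linarith : 0 ≤ a)
    rwa [mul_div_cancel₀ _ (by linarith)] at this
  rw [mulLogb_one] at h
  linarith

/-- The binary entropy function is at most `1`. -/
theorem mulLogb_add_le {a b : ℝ} (ha : 0 < a) (hb : 0 < b) :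
    mulLogb (a + b) ≤ mulLogb a + mulLogb b + (a + b) := by
  -- Convexity of `x log x` at the midpoint of `a` and `b`; the factor `1 / 2` inside the logarithm
  -- produces the term `a + b`.
  have h := Real.convexOn_mul_log.2 (x := a) (y := b) ha.le hb.le
    (show (0 : ℝ) ≤ 1 / 2 by norm_num) (show (0 : ℝ) ≤ 1 / 2 by norm_num) (by norm_num)
  simp only [smul_eq_mul] at h
  have h1 : (1 / 2 * a + 1 / 2 * b) = (a + b) / 2 := by ring
  rw [h1, Real.log_div (by positivity) two_ne_zero] at h
  have h2 : (a + b) * Real.log (a + b) ≤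
      a * Real.log a + b * Real.log b + (a + b) * Real.log 2 := by nlinarith
  have hl : 0 < Real.log 2 := Real.log_pos one_lt_two
  have key : ∀ x : ℝ, mulLogb x = x * Real.log x / Real.log 2 := fun x => by
    rw [mulLogb, Real.logb, mul_div_assoc]
  rw [key, key, key, ← add_div, div_add' _ _ _ hl.ne', div_le_div_iff_of_pos_right hl]
  exact h2

/-- This is `2 ^ 4 ≤ 3 ^ 3`. -/
theorem four_le_mulLogb_three : 4 ≤ mulLogb 3 := by
  have : (4 : ℝ) = Real.logb 2 (2 ^ 4) := by
    rw [Real.logb_pow]; norm_num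
  have h2 : mulLogb 3 = Real.logb 2 (3 ^ 3) := by
    rw [Real.logb_pow, mulLogb]; norm_num
  rw [this, h2]
  exact Real.logb_le_logb_of_le one_lt_two (by norm_num) (by norm_num)

/-! ### The amortized bound -/

/-- The amortized bound for PeekSort on a range of `N` elements that consists of `k` runs, where
`w` is the sum of `x log₂ x` over the lengths of these runs, `a` and `b` are the numbers of
positions by which the known sorted prefix and suffix exceed one element, `mc` is the merge cost and
`c` is the number of comparisons. -/
structure CostBound (k N a b : ℕ) (w : ℝ) (mc c : ℕ) : Prop where
  merge : (mc : ℝ) + w + a + b + k + 1 + (if k = 1 then 0 else 1) ≤ mulLogb N + 2 * N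
  entropy_one : k = 1 → w = mulLogb N
  comp_one : k = 1 → c + a + b + 1 ≤ N
  comp : 2 ≤ k → (c : ℝ) + w + 2 * a + 2 * b + 2 * k + 3 ≤ mulLogb N + 3 * N

namespace CostBound

/-- Reversing a range exchanges prefix and suffix, so the mirror-image branches of the algorithm
need no separate computation. -/
theorem swap {k N a b : ℕ} {w : ℝ} {mc c : ℕ} (h : CostBound k N a b w mc c) :
    CostBound k N b a w mc c :=
  ⟨by have := h.merge; linarith, h.entropy_one, fun hk => by have := h.comp_one hk; omega,
    fun hk => by have := h.comp hk; linarith⟩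

theorem single {N a b : ℕ} {w : ℝ} {mc c : ℕ} (hw : w = mulLogb N) (hmc : mc + a + b + 2 ≤ 2 * N)
    (hc : c + a + b + 1 ≤ N) : CostBound 1 N a b w mc c := by
  refine ⟨?_, fun _ => hw, fun _ => hc, by omega⟩
  have : ((mc + a + b + 2 : ℕ) : ℝ) ≤ (2 * N : ℕ) := by exact_mod_cast hmc
  push_cast at this
  simp only [if_true]
  push_cast
  linarith

theorem comp_one_cast {N a b : ℕ} {w : ℝ} {mc c : ℕ} (h : CostBound 1 N a b w mc c) :
    (c : ℝ) + a + b + 1 ≤ N := by exact_mod_cast h.comp_one rfl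

/-- Splitting off a known run that makes up at least half of the range. -/
theorem cons {k M L b : ℕ} {w : ℝ} {mc c mc' c' : ℕ} (h : CostBound k M 0 b w mc c)
    (hk : 1 ≤ k) (hM : 1 ≤ M) (hML : M ≤ L) (hmc : mc' = mc + (L + M))
    (hc : c' + 1 ≤ c + (L + M)) :
    CostBound (k + 1) (L + M) (L - 1) b (mulLogb L + w) mc' c' := by
  have hent := mulLogb_add_ge (a := L) (b := M) (by exact_mod_cast hM) (by exact_mod_cast hML)
  obtain ⟨L, rfl⟩ : ∃ L', L = L' + 1 := ⟨L - 1, by omega⟩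
  have hM' : (1 : ℝ) ≤ M := by exact_mod_cast hM
  have hc' : (c' : ℝ) + 1 ≤ c + (L + 1 + M) := by exact_mod_cast hc
  subst hmc
  refine ⟨?_, by omega, by omega, fun _ => ?_⟩
  · have := h.merge
    rw [if_neg (by omega)]
    push_cast at *
    split_ifs at this <;> linarith
  · push_cast at *
    rcases Nat.lt_or_ge k 2 with hk2 | hk2
    · obtain rfl : k = 1 := by omega
      have h1 := h.comp_one_cast
      have h2 := h.entropy_one rfl
      have h3 : (0 : ℝ) ≤ c := by positivity
      push_cast at *
      linarith
    · have := h.comp hk2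
      linarith

/-- Splitting a range at the boundary that is closest to its midpoint, when the run of length `L`
at the midpoint is found by `t` comparisons. It belongs to the larger part. -/
theorem append {k K N M a b L t : ℕ} {w v : ℝ} {mc c MC C mc' c' : ℕ}
    (h : CostBound k N a 0 w mc c) (H : CostBound K M (L - 1) b v MC C)
    (hk : 1 ≤ k) (hK : 1 ≤ K) (hN : 1 ≤ N) (hNM : N ≤ M) (hL : 1 ≤ L) (hd : M ≤ N + L)
    (ht : t ≤ L + if 2 ≤ K then 1 else 0) (h1 : K = 1 → L = M) (h3 : 3 ≤ N + M)
    (hKM : K ≤ M)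
    (hspecial : ¬ (k = 1 ∧ K = 2 ∧ N = 1 ∧ M = 2))
    (hmc : mc' = mc + MC + (N + M)) (hc : c' + 1 ≤ t + c + C + (N + M)) :
    CostBound (k + K) (N + M) a b (w + v) mc' c' := by
  have hent := mulLogb_add_ge (a := M) (b := N) (by exact_mod_cast hN) (by exact_mod_cast hNM)
  -- From here on `L` is the length of the run minus one, which is the saving in the call on the
  -- larger part.
  obtain ⟨L, rfl⟩ : ∃ L', L = L' + 1 := ⟨L - 1, by omega⟩
  have hN' : (1 : ℝ) ≤ N := by exact_mod_cast hN
  have hd' : (M : ℝ) ≤ N + (L + 1) := by exact_mod_cast hd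
  have hNM' : (N : ℝ) ≤ M := by exact_mod_cast hNM
  have h3' : (3 : ℝ) ≤ N + M := by exact_mod_cast h3
  have hc' : (c' : ℝ) + 1 ≤ t + c + C + (N + M) := by exact_mod_cast hc
  have hadd : (N : ℝ) + M = M + N := add_comm _ _
  have hM3 : k = 1 → 2 ≤ K → N = 1 → 3 ≤ M := by omega
  subst hmc
  simp only [Nat.add_sub_cancel] at H
  refine ⟨?_, by omega, by omega, fun _ => ?_⟩
  · have e1 := h.merge
    have e2 := H.merge
    rw [if_neg (by omega)]
    push_cast at *
    rw [hadd]
    -- One unit is missing. If the larger part has several runs, its own merge bound carries that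
    -- unit. If it is a single run, this run fills it, so `M - N` is strictly less than the length
    -- of the run.
    rcases Nat.lt_or_ge K 2 with hK2 | hK2
    · have hK1 : K = 1 := by omega
      have : (L : ℝ) + 1 = M := by exact_mod_cast h1 hK1
      split_ifs at e1 e2 <;> linarith
    · rw [if_neg (by omega)] at e2
      split_ifs at e1 <;> linarith
  · rcases Nat.lt_or_ge K 2 with hK2 | hK2
    · obtain rfl : K = 1 := by omega
      have hLM := h1 rfl
      have hv := H.entropy_one rfl
      have hC := H.comp_one rfl
      obtain ⟨rfl, rfl⟩ : C = 0 ∧ b = 0 := by omega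
      have ht' : (t : ℝ) ≤ L + 1 := by exact_mod_cast ht
      have hLM' : (L : ℝ) + 1 = M := by exact_mod_cast hLM
      push_cast at *
      rw [hadd]
      -- With one run in each part, the estimate comes down to `4 ≤ 2 * N + M`, which is where `3 ≤
      -- N + M` enters.
      rcases Nat.lt_or_ge k 2 with hk2 | hk2
      · obtain rfl : k = 1 := by omega
        have e1 := h.comp_one_cast
        have e2 := h.entropy_one rfl
        have e3 : (0 : ℝ) ≤ c := by positivity
        push_cast at *
        linarith
      · have e1 := h.comp hk2
        push_cast at *
        linarith
    · rw [if_pos hK2] at ht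
      have ht' : (t : ℝ) ≤ L + 1 + 1 := by exact_mod_cast ht
      have E2 := H.comp hK2
      push_cast at *
      rw [hadd]
      rcases Nat.lt_or_ge k 2 with hk2 | hk2
      · obtain rfl : k = 1 := by omega
        have e1 := h.comp_one_cast
        have e2 := h.entropy_one rfl
        have e3 : (0 : ℝ) ≤ c := by positivity
        push_cast at *
        -- The comparison bound for a smaller part that is a single run is one unit short if `N = 1`
        -- and the imbalance is extremal. Strict imbalance or `N ≥ 2` avoids this; otherwise
        -- `mulLogb_add_one_ge` supplies the unit, as `M = 2` is excluded.
        rcases Nat.lt_or_ge M (N + (L + 1)) with hlt | hge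
        · have : (M : ℝ) + 1 ≤ N + (L + 1) := by exact_mod_cast hlt
          linarith
        rcases Nat.lt_or_ge N 2 with hlt | hge2
        · obtain rfl : N = 1 := by omega
          have := mulLogb_add_one_ge (a := M) (by exact_mod_cast hM3 trivial hK2 rfl)
          simp only [Nat.cast_one, mulLogb_one] at *
          linarith
        · have : (2 : ℝ) ≤ N := by exact_mod_cast hge2
          linarith
      · have e1 := h.comp hk2
        linarith

end CostBound

/-! ### The costs of PeekSort -/

section

variable {ι : Type} {α : Type*} [LinearOrder α] {A : ι → α} {test : ℕ → CompTree ι ScanStep}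
  {d l r e s : ℕ} {arr : List ι}

theorem peekSortAux_of_sorted (h : e = r ∨ s = l) :
    peekSortAux test (d + 1) arr l r e s = pure (slice arr l r, 0) := by
  rw [peekSortAux, if_pos h]

theorem peekSortAux_of_mid_le (h : ¬ (e = r ∨ s = l)) (hm : l + (r - l) / 2 ≤ e) :
    peekSortAux test (d + 1) arr l r e s = (do
      let q ← peekSortAux test d arr (e + 1) r (e + 1) s
      mergeStep (slice arr l e, 0) q) := by
  rw [peekSortAux, if_neg h]
  exact if_pos hm

theorem peekSortAux_of_le_mid (h : ¬ (e = r ∨ s = l)) (hm : ¬ l + (r - l) / 2 ≤ e)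
    (hs : s ≤ l + (r - l) / 2) :
    peekSortAux test (d + 1) arr l r e s = (do
      let p ← peekSortAux test d arr l (s - 1) e (s - 1)
      mergeStep p (slice arr s r, 0)) := by
  rw [peekSortAux, if_neg h]
  exact (if_neg hm).trans (if_pos hs)

/-- The execution of PeekSort after the run `A[i..j]` at the midpoint has been found. -/
theorem peekSortAux_of_mid {i j m : ℕ} {u v : Bool} (hmid : m = l + (r - l) / 2)
    (h : ¬ (e = r ∨ s = l))
    (hm : ¬ m ≤ e) (hs : ¬ s ≤ m)
    (hi : (extendRunLeft test l m).run A = (i, u))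
    (hj : (extendRunRight test (r - m) m).run A = (j, v)) :
    ∃ T : CompTree ι (List ι × ℕ),
      (peekSortAux test (d + 1) arr l r e s).run A = T.run A ∧
      (peekSortAux test (d + 1) arr l r e s).cost A =
        (extendRunLeft test l m).cost A +
        (extendRunRight test (r - m) m).cost A + T.cost A ∧
      T = let arr' := if u || v then reverseSlice arr i j else arr
        if i = l ∧ j = r then pure (slice arr' l r, 0)
        else if m - i < j - m then
          peekSortAux test d arr' l (i - 1) e (i - 1) >>= fun p =>
            peekSortAux test d arr' i r j s >>= fun q => mergeStep p q
        else
          peekSortAux test d arr' l j e i >>= fun p =>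
            peekSortAux test d arr' (j + 1) r (j + 1) s >>= fun q => mergeStep p q := by
  subst hmid
  refine ⟨_, ?_, ?_, rfl⟩
  · rw [peekSortAux, if_neg h]
    dsimp only
    rw [if_neg hm, if_neg hs, run_bind, hi]
    dsimp only
    rw [run_bind, hj]
  · rw [peekSortAux, if_neg h]
    dsimp only
    rw [if_neg hm, if_neg hs, cost_bind, hi]
    dsimp only
    rw [cost_bind, hj, add_assoc]

end

/-! ### Cost bounds for ranges of consecutive runs -/

/-- The sum of `x log₂ x` over the lengths of the runs `p, …, q - 1`. -/
noncomputable def runWeight (L : List ℕ) (p q : ℕ) : ℝ :=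
  ∑ i ∈ Finset.Ico p q, mulLogb ((segStart L (i + 1) - segStart L i : ℕ) : ℝ)

theorem runWeight_append (L : List ℕ) {p t q : ℕ} (h1 : p ≤ t) (h2 : t ≤ q) :
    runWeight L p q = runWeight L p t + runWeight L t q :=
  (Finset.sum_Ico_consecutive _ h1 h2).symm

theorem runWeight_single (L : List ℕ) (p : ℕ) :
    runWeight L p (p + 1) = mulLogb ((segStart L (p + 1) - segStart L p : ℕ) : ℝ) := by
  simp [runWeight]

section

variable {α : Type*} [LinearOrder α] {n : ℕ} {A : Fin n → α} {L : List ℕ}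
  {test : ℕ → CompTree (Fin n) ScanStep}

/-- The entries that form runs of length `1` are at their original places. -/
structure SingletonsInPlace (n : ℕ) (L : List ℕ) (arr : List (Fin n)) : Prop where
  length : arr.length = n
  getElem? : ∀ t (h : segStart L t < n), segStart L (t + 1) = segStart L t + 1 →
    arr[segStart L t]? = some ⟨segStart L t, h⟩

theorem SingletonsInPlace.finRange (n : ℕ) (L : List ℕ) :
    SingletonsInPlace n L (List.finRange n) :=
  ⟨by simp, fun t h _ => by simp [h]⟩

/-- Reversing a whole run moves only its own entries: other runs of length one lie outside of it,
and reversing a run of length one changes nothing. -/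
theorem SingletonsInPlace.reverseSlice {arr : List (Fin n)} (h : SingletonsInPlace n L arr)
    {t i j : ℕ} (hi : i = segStart L t) (hj : j + 1 = segStart L (t + 1)) (hij : i ≤ j)
    (hn : j < n) (b : Bool) :
    SingletonsInPlace n L (if b then _root_.reverseSlice arr i j else arr) := by
  cases b
  · simpa using h
  simp only [if_true]
  rcases hij.eq_or_lt with rfl | hlt
  · rwa [reverseSlice_self]
  refine ⟨by rw [length_reverseSlice hij (by rwa [h.length]), h.length], fun u hu hu1 => ?_⟩
  rw [getElem?_reverseSlice hij (by rwa [h.length]), h.getElem? u hu hu1]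
  rcases lt_trichotomy u t with hut | rfl | hut
  · have := segStart_mono L (show u + 1 ≤ t from hut); omega
  · omega
  · have := segStart_mono L (show t + 1 ≤ u from hut); omega

/-- The computation `T` sorts the runs `p, …, q - 1` within the amortized cost bound. -/
structure RangeBound (A : Fin n → α) (L : List ℕ) (p q e s : ℕ)
    (T : CompTree (Fin n) (List (Fin n) × ℕ)) : Prop where
  length : (T.run A).1.length = segStart L q - segStart L p
  bound : CostBound (q - p) (segStart L q - segStart L p) (e - segStart L p)
    (segStart L q - 1 - s) (runWeight L p q) (T.run A).2 (T.cost A)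

/-- The prefix up to `e` and the suffix from `s` of the range of the runs `p, …, q - 1` are single
elements or entire runs. -/
structure Known (L : List ℕ) (p q e s : ℕ) : Prop where
  left : e = segStart L p ∨ e + 1 = segStart L (p + 1)
  right : s + 1 = segStart L q ∨ s = segStart L (q - 1)
  one : q = p + 1 → e = segStart L p ∨ s + 1 = segStart L q

/-- A single run is either known already, or has two elements and is merged, or is recognized by a
scan that never tests a boundary. The second conclusion is kept because for `k = 1` the merge bound
in `CostBound` is one unit weaker than the final claim. -/
theorem rangeBound_single (hA : IsRunDecomposition A L) (ht : DetectsRuns A L test) {d p e s : ℕ}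
    {arr : List (Fin n)} (harr : arr.length = n) (hp : p < L.length)
    (hd : segStart L (p + 1) - segStart L p ≤ d) (hk : Known L p (p + 1) e s) :
    RangeBound A L p (p + 1) e s
      (peekSortAux test d arr (segStart L p) (segStart L (p + 1) - 1) e s) ∧
    (3 ≤ segStart L (p + 1) - segStart L p →
      ((peekSortAux test d arr (segStart L p) (segStart L (p + 1) - 1) e s).run A).2 = 0) := by
  have hlt := segStart_lt_succ hA.pos hp
  have hn : segStart L (p + 1) ≤ n := by
    rw [← hA.sum, ← segStart_length]; exact segStart_mono L hp
  obtain ⟨hl, hr, h1⟩ := hk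
  have h1 := h1 rfl
  simp only [Nat.add_sub_cancel] at hr
  obtain ⟨d, rfl⟩ : ∃ d', d = d' + 1 := ⟨d - 1, by omega⟩
  by_cases hret : e = segStart L (p + 1) - 1 ∨ s = segStart L p
  · rw [peekSortAux_of_sorted hret]
    refine ⟨⟨?_, ?_⟩, fun _ => by simp [run_pure]⟩
    · simp only [run_pure]
      rw [length_slice (by omega)]; omega
    · simp only [run_pure, cost_pure, Nat.add_sub_cancel_left]
      exact CostBound.single (runWeight_single L p) (by omega) (by omega)
  · obtain rfl : e = segStart L p := by omega
    obtain rfl : s = segStart L (p + 1) - 1 := by omega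
    -- As `e` and `s` are now the two ends of the range, the midpoint does not exceed `e` only for a
    -- run of length two, which is sorted by one merge.
    by_cases hm : segStart L p + (segStart L (p + 1) - 1 - segStart L p) / 2 ≤ segStart L p
    · rw [peekSortAux_of_mid_le hret hm]
      obtain ⟨d, rfl⟩ : ∃ d', d = d' + 1 := ⟨d - 1, by omega⟩
      rw [peekSortAux_of_sorted (by omega)]
      have hs1 : (slice arr (segStart L p) (segStart L p)).length = 1 := by
        rw [length_slice (by omega)]; omega
      have hs2 : (slice arr (segStart L p + 1) (segStart L (p + 1) - 1)).length = 1 := by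
        rw [length_slice (by omega)]; omega
      have hcost := cost_mergeLists_le A (slice arr (segStart L p) (segStart L p))
        (slice arr (segStart L p + 1) (segStart L (p + 1) - 1))
      refine ⟨⟨?_, ?_⟩, fun _ => by omega⟩
      · simp only [run_bind, run_pure, run_mergeStep, length_mergeLists]
        omega
      · simp only [run_bind, run_pure, run_mergeStep, cost_bind, cost_pure, cost_mergeStep,
          Nat.add_sub_cancel_left]
        exact CostBound.single (runWeight_single L p) (by omega) (by omega)
    · obtain ⟨hi, hic⟩ := ht.extendRunLeft (le_refl p)
        (segStart L p + (segStart L (p + 1) - 1 - segStart L p) / 2) (by omega) (by omega) (by omega)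
      obtain ⟨hj, hjc⟩ := ht.extendRunRight (t := p) (r := segStart L (p + 1) - 1) (by omega)
        (by omega) (segStart L (p + 1) - 1 -
          (segStart L p + (segStart L (p + 1) - 1 - segStart L p) / 2))
        (segStart L p + (segStart L (p + 1) - 1 - segStart L p) / 2) (by omega) (by omega) (by omega)
      rw [if_neg (by omega)] at hic hjc
      obtain ⟨T, hrun, hcost, hT⟩ := peekSortAux_of_mid (d := d) (arr := arr) (A := A) rfl hret hm
        (by omega) (Prod.mk.eta).symm (Prod.mk.eta).symm
      rw [hi, show ((extendRunRight test _ _).run A).1 = segStart L (p + 1) - 1 by omega] at hT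
      simp only [and_self, if_true] at hT
      subst hT
      have hlen := length_reverseSlice (arr := arr) (a := segStart L p)
        (b := segStart L (p + 1) - 1) (by omega) (by omega)
      refine ⟨⟨?_, ?_⟩, fun _ => by rw [hrun]; rfl⟩
      · rw [hrun]
        simp only [run_pure]
        split_ifs
        · rw [length_slice (by omega)]; omega
        · rw [length_slice (by omega)]; omega
      · rw [hrun, hcost]
        simp only [run_pure, cost_pure, Nat.add_sub_cancel_left]
        exact CostBound.single (runWeight_single L p) (by omega) (by omega)

end

/-! ### Joining the two parts of a range, and the induction over the recursion -/

section

variable {α : Type*} [LinearOrder α] {n : ℕ} {A : Fin n → α} {L : List ℕ}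
  {test : ℕ → CompTree (Fin n) ScanStep}

theorem length_merge {ι : Type} (A : ι → α) (T U : CompTree ι (List ι × ℕ)) :
    ((T >>= fun p => U >>= fun q => mergeStep p q).run A).1.length =
      (T.run A).1.length + (U.run A).1.length := by
  simp only [run_bind, run_mergeStep, length_mergeLists]

theorem mergeCost_merge {ι : Type} (A : ι → α) (T U : CompTree ι (List ι × ℕ)) :
    ((T >>= fun p => U >>= fun q => mergeStep p q).run A).2 =
      (T.run A).2 + (U.run A).2 + ((T.run A).1.length + (U.run A).1.length) := by
  simp only [run_bind, run_mergeStep]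

theorem cost_merge_le {ι : Type} (A : ι → α) (T U : CompTree ι (List ι × ℕ)) :
    (T >>= fun p => U >>= fun q => mergeStep p q).cost A ≤ T.cost A + U.cost A +
      ((T.run A).1.length + (U.run A).1.length - 1) := by
  have := cost_mergeLists_le A (T.run A).1 (U.run A).1
  simp only [cost_bind, cost_mergeStep]
  omega

/-- The branch `m ≤ e`: the known prefix is the whole first run and makes up at least half of the
range, so `CostBound.cons` applies. The prefix known to the recursive call is a single element and
brings no saving. -/
theorem RangeBound.cons (hA : IsRunDecomposition A L) {p q e s : ℕ}
    {U : CompTree (Fin n) (List (Fin n) × ℕ)} {xs : List (Fin n)} (hpq : p + 1 < q)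
    (hq : q ≤ L.length) (he : e + 1 = segStart L (p + 1))
    (hxs : xs.length = segStart L (p + 1) - segStart L p)
    (hle : segStart L q - segStart L (p + 1) ≤ segStart L (p + 1) - segStart L p)
    (hU : RangeBound A L (p + 1) q (segStart L (p + 1)) s U) :
    RangeBound A L p q e s (U >>= fun y => mergeStep (xs, 0) y) := by
  have h1 := segStart_lt hA.pos (show p < p + 1 by omega) (by omega)
  have h2 := segStart_lt hA.pos hpq hq
  have hlen := length_merge A (pure (xs, 0)) U
  have hmc := mergeCost_merge A (pure (xs, 0)) U
  have hc := cost_merge_le A (pure (xs, 0)) U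
  rw [hU.length] at hlen hmc hc
  simp only [run_bind A (pure _), cost_bind A (pure _), run_pure, cost_pure, hxs] at hlen hmc hc
  have hb := hU.bound
  rw [Nat.sub_self] at hb
  have := hb.cons (L := segStart L (p + 1) - segStart L p) (by omega) (by omega) hle
    (hmc.trans (by omega)) (c' := (U >>= fun y => mergeStep (xs, 0) y).cost A) (by omega)
  refine ⟨by omega, ?_⟩
  rw [runWeight_append L (show p ≤ p + 1 by omega) hpq.le, runWeight_single,
    show q - p = q - (p + 1) + 1 by omega,
    show segStart L q - segStart L p =
      segStart L (p + 1) - segStart L p + (segStart L q - segStart L (p + 1)) by omega,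
    show e - segStart L p = segStart L (p + 1) - segStart L p - 1 by omega]
  exact this

theorem RangeBound.snoc (hA : IsRunDecomposition A L) {p q e s : ℕ}
    {T : CompTree (Fin n) (List (Fin n) × ℕ)} {ys : List (Fin n)} (hpq : p < q)
    (hq : q + 1 ≤ L.length) (hs : s = segStart L q)
    (hys : ys.length = segStart L (q + 1) - segStart L q)
    (hle : segStart L q - segStart L p ≤ segStart L (q + 1) - segStart L q)
    (hT : RangeBound A L p q e (s - 1) T) :
    RangeBound A L p (q + 1) e s (T >>= fun x => mergeStep x (ys, 0)) := by
  subst hs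
  have h1 := segStart_lt hA.pos (show q < q + 1 by omega) (by omega)
  have h2 := segStart_lt hA.pos hpq (by omega)
  have hlen := length_merge A T (pure (ys, 0))
  have hmc := mergeCost_merge A T (pure (ys, 0))
  have hc := cost_merge_le A T (pure (ys, 0))
  have hT' : (T >>= fun x => pure (ys, 0) >>= fun y => mergeStep x y) =
    (T >>= fun x => mergeStep x (ys, 0)) := rfl
  rw [hT'] at hlen hmc hc
  rw [hT.length] at hlen hmc hc
  simp only [run_pure, cost_pure, hys] at hlen hmc hc
  have hb := hT.bound.swap
  rw [Nat.sub_self] at hb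
  have := (hb.cons (L := segStart L (q + 1) - segStart L q) (by omega) (by omega) hle
    (hmc.trans (by omega)) (c' := (T >>= fun x => mergeStep x (ys, 0)).cost A) (by omega)).swap
  refine ⟨by omega, ?_⟩
  rw [runWeight_append L hpq.le (show q ≤ q + 1 by omega), runWeight_single, add_comm (runWeight _ _ _),
    show q + 1 - p = q - p + 1 by omega,
    show segStart L (q + 1) - segStart L p =
      segStart L (q + 1) - segStart L q + (segStart L q - segStart L p) by omega,
    show segStart L (q + 1) - 1 - segStart L q = segStart L (q + 1) - segStart L q - 1 by omega]
  exact this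

/-- A split to the left of the run `t` at the midpoint. -/
theorem RangeBound.append_left (hA : IsRunDecomposition A L) {p t q e s c : ℕ}
    {T U X : CompTree (Fin n) (List (Fin n) × ℕ)} (hpt : p < t) (htq : t < q) (hq : q ≤ L.length)
    (hrun : X.run A = (T >>= fun x => U >>= fun y => mergeStep x y).run A)
    (hcost : X.cost A = c + (T >>= fun x => U >>= fun y => mergeStep x y).cost A)
    (hT : RangeBound A L p t e (segStart L t - 1) T)
    (hU : RangeBound A L t q (segStart L (t + 1) - 1) s U)
    (hle : segStart L t - segStart L p ≤ segStart L q - segStart L t)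
    (hd : segStart L q - segStart L t ≤
      segStart L t - segStart L p + (segStart L (t + 1) - segStart L t))
    (hc : c ≤ segStart L (t + 1) - segStart L t + if t + 1 < q then 1 else 0)
    (h3 : segStart L p + 3 ≤ segStart L q)
    (hspecial : ¬ (q = p + 3 ∧ segStart L q = segStart L p + 3)) :
    RangeBound A L p q e s X := by
  have h1 := segStart_lt hA.pos hpt (by omega)
  have h2 := segStart_lt hA.pos (show t < t + 1 by omega) (by omega)
  have h4 := segStart_mono L (show t + 1 ≤ q from htq)
  have h5 := segStart_add_le hA.pos htq.le hq
  have hlen := length_merge A T U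
  have hmc := mergeCost_merge A T U
  have hmcost := cost_merge_le A T U
  rw [hT.length, hU.length] at hlen hmc hmcost
  rw [← hrun] at hlen hmc
  have hb := hT.bound
  have hB := hU.bound
  rw [Nat.sub_self] at hb
  rw [show segStart L (t + 1) - 1 - segStart L t = segStart L (t + 1) - segStart L t - 1 by omega]
    at hB
  have := hb.append hB (by omega) (by omega) (by omega) hle (by omega) hd (t := c)
    (by split_ifs at hc ⊢ <;> omega)
    (fun h => by rw [show q = t + 1 by omega]) (by omega) (by omega) (by omega) hmc
    (c' := X.cost A) (by omega)
  refine ⟨by omega, ?_⟩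
  rw [runWeight_append L hpt.le htq.le, show q - p = t - p + (q - t) by omega,
    show segStart L q - segStart L p =
      segStart L t - segStart L p + (segStart L q - segStart L t) by omega]
  exact this

/-- A split to the right of the run `t` at the midpoint. -/
theorem RangeBound.append_right (hA : IsRunDecomposition A L) {p t q e s c : ℕ}
    {T U X : CompTree (Fin n) (List (Fin n) × ℕ)} (hpt : p ≤ t) (htq : t + 1 < q)
    (hq : q ≤ L.length)
    (hrun : X.run A = (T >>= fun x => U >>= fun y => mergeStep x y).run A)
    (hcost : X.cost A = c + (T >>= fun x => U >>= fun y => mergeStep x y).cost A)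
    (hT : RangeBound A L p (t + 1) e (segStart L t) T)
    (hU : RangeBound A L (t + 1) q (segStart L (t + 1)) s U)
    (hle : segStart L q - segStart L (t + 1) ≤ segStart L (t + 1) - segStart L p)
    (hd : segStart L (t + 1) - segStart L p ≤
      segStart L q - segStart L (t + 1) + (segStart L (t + 1) - segStart L t))
    (hc : c ≤ segStart L (t + 1) - segStart L t + if p < t then 1 else 0)
    (h3 : segStart L p + 3 ≤ segStart L q)
    (hspecial : ¬ (q = p + 3 ∧ segStart L q = segStart L p + 3)) :
    RangeBound A L p q e s X := by
  have h1 := segStart_mono L hpt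
  have h2 := segStart_lt hA.pos (show t < t + 1 by omega) (by omega)
  have h4 := segStart_lt hA.pos htq hq
  have h5 := segStart_add_le hA.pos (show p ≤ t + 1 by omega) (by omega)
  have hlen := length_merge A T U
  have hmc := mergeCost_merge A T U
  have hmcost := cost_merge_le A T U
  rw [hT.length, hU.length] at hlen hmc hmcost
  rw [← hrun] at hlen hmc
  have hb := hU.bound.swap
  have hB := hT.bound.swap
  rw [Nat.sub_self] at hb
  rw [show segStart L (t + 1) - 1 - segStart L t = segStart L (t + 1) - segStart L t - 1 by omega]
    at hB
  have := (hb.append hB (by omega) (by omega) (by omega) hle (by omega) hd (t := c)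
    (by split_ifs at hc ⊢ <;> omega)
    (fun h => by rw [show p = t by omega]) (by omega) (by omega) (by omega) (hmc.trans (by omega))
    (c' := X.cost A) (by omega)).swap
  refine ⟨by omega, ?_⟩
  rw [runWeight_append L (show p ≤ t + 1 by omega) htq.le, add_comm (runWeight _ _ _),
    show q - p = q - (t + 1) + (t + 1 - p) by omega,
    show segStart L q - segStart L p =
      segStart L q - segStart L (t + 1) + (segStart L (t + 1) - segStart L p) by omega]
  exact this

theorem slice_self {ι : Type} {arr : List ι} {a : ℕ} {x : ι} (h : arr[a]? = some x) :
    slice arr a a = [x] := by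
  obtain ⟨ha, rfl⟩ := List.getElem?_eq_some_iff.1 h
  rw [slice, Nat.add_sub_cancel_left, List.drop_eq_getElem_cons ha]
  rfl

/-- A segment of two elements that is not weakly increasing is a descent. -/
theorem IsRunDecomposition.gt_of_length_one (hA : IsRunDecomposition A L) {i : ℕ}
    (hi : i + 1 < L.length) (h : segStart L (i + 1) = segStart L i + 1)
    (hn : segStart L (i + 1) < n) :
    A ⟨segStart L (i + 1), hn⟩ < A ⟨segStart L i, by omega⟩ := by
  by_contra hc
  refine hA.maximal i hi fun x y hx hxy hy => ?_
  have hxy' : (x : ℕ) < y := hxy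
  have hx' : x = ⟨segStart L i, by omega⟩ := Fin.ext (by simp only; omega)
  have hy' : y = ⟨segStart L (i + 1), hn⟩ := Fin.ext (by simp only; omega)
  rw [hx', hy']
  exact not_lt.1 hc

/-- A range that consists of three runs of length `1`, hence is strictly decreasing. -/
theorem rangeBound_three (hA : IsRunDecomposition A L) (ht : DetectsRuns A L test) {d p : ℕ}
    {arr : List (Fin n)} (harr : SingletonsInPlace n L arr) (hp : p + 3 ≤ L.length)
    (h3 : segStart L (p + 3) = segStart L p + 3) (hd : 3 ≤ d) :
    RangeBound A L p (p + 3) (segStart L p) (segStart L p + 2)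
      (peekSortAux test d arr (segStart L p) (segStart L p + 2) (segStart L p)
        (segStart L p + 2)) := by
  have hpos := hA.pos
  have a1 := segStart_lt hpos (show p < p + 1 by omega) (by omega)
  have a2 := segStart_lt hpos (show p + 1 < p + 2 by omega) (by omega)
  have a3 := segStart_lt hpos (show p + 2 < p + 3 by omega) (by omega)
  have s1 : segStart L (p + 1) = segStart L p + 1 := by omega
  have s2 : segStart L (p + 2) = segStart L p + 2 := by omega
  have s2' : segStart L (p + 1 + 1) = segStart L p + 2 := s2
  have s3' : segStart L (p + 2 + 1) = segStart L p + 3 := h3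
  have hn : segStart L p + 3 ≤ n := by
    rw [← hA.sum, ← segStart_length, ← h3]; exact segStart_mono L hp
  have e0 := harr.getElem? p (by omega) s1
  have e1 := harr.getElem? (p + 1) (by omega) (by omega)
  have e2 := harr.getElem? (p + 2) (by omega) (by omega)
  have m0 := hA.gt_of_length_one (i := p) (by omega) s1 (by omega)
  have m1 := hA.gt_of_length_one (i := p + 1) (by omega) (by omega) (by omega)
  simp only [s1, s2] at e1 e2 m0 m1
  have c0 := slice_self e0
  have c1 := slice_self e1
  have c2 := slice_self e2
  obtain ⟨hi, hic⟩ := ht.extendRunLeft (show p ≤ p + 1 by omega) (segStart L p + 1) s1.le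
    (by omega) (by omega)
  obtain ⟨hj, hjc⟩ := ht.extendRunRight (t := p + 1) (r := segStart L p + 2) (by omega) (by omega) 1
    (segStart L p + 1) (by omega) (by omega) (by omega)
  obtain ⟨i, u, hiu⟩ : ∃ i u, (extendRunLeft test (segStart L p) (segStart L p + 1)).run A =
    (i, u) := ⟨_, _, rfl⟩
  obtain ⟨j, v, hjv⟩ : ∃ j v, (extendRunRight test 1 (segStart L p + 1)).run A = (j, v) :=
    ⟨_, _, rfl⟩
  rw [hiu] at hi
  rw [hjv] at hj
  obtain rfl : i = segStart L p + 1 := by simp only at hi; omega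
  obtain rfl : j = segStart L p + 1 := by simp only at hj; omega
  obtain ⟨d, rfl⟩ : ∃ d', d = d' + 3 := ⟨d - 3, by omega⟩
  have hm : segStart L p + (segStart L p + 2 - segStart L p) / 2 = segStart L p + 1 := by omega
  have hm' : segStart L p + 2 - (segStart L p + 1) = 1 := by omega
  obtain ⟨T, hrun, hcost, hT⟩ := peekSortAux_of_mid (d := d + 2) (arr := arr) (A := A)
    (test := test) (l := segStart L p) (r := segStart L p + 2) (e := segStart L p)
    (s := segStart L p + 2) (i := segStart L p + 1) (j := segStart L p + 1) (u := u) (v := v) hm.symm (by omega)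
    (by omega) (by omega) hiu (by rw [hm']; exact hjv)
  rw [hm'] at hcost
  -- The run at the midpoint has length one, so the direction reported by the scan does not matter.
  simp only [reverseSlice_self, ite_self] at hT
  rw [if_neg (by omega), if_neg (by omega), peekSortAux_of_mid_le (by omega) (by omega),
    peekSortAux_of_sorted (Or.inl rfl), peekSortAux_of_sorted (Or.inl rfl), c0, c1, c2] at hT
  subst hT
  simp only [run_bind, run_pure, cost_bind, cost_pure, run_mergeStep, cost_mergeStep,
    run_mergeLists_singleton_of_lt A m0, cost_mergeLists_singleton_of_lt A _ _ m0,
    cost_mergeLists_singleton_of_lt A _ _ m1] at hrun hcost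
  split_ifs at hic hjc <;> try omega
  have h4 := four_le_mulLogb_three
  have hw : runWeight L p (p + 3) = 0 := by
    rw [runWeight_append L (show p ≤ p + 2 by omega) (by omega),
      runWeight_append L (show p ≤ p + 1 by omega) (by omega), runWeight_single, runWeight_single,
      runWeight_single, h3, s1, s2]
    simp [mulLogb_one]
  refine ⟨by rw [hrun]; simp only [length_mergeLists, h3, List.length_cons, List.length_nil]; omega, ?_⟩
  rw [hrun, hw, h3, Nat.sub_self, show p + 3 - p = 3 by omega,
    show segStart L p + 3 - segStart L p = 3 by omega,
    show segStart L p + 3 - 1 - (segStart L p + 2) = 0 by omega]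
  refine ⟨?_, by omega, by omega, fun _ => ?_⟩
  · simp
    linarith
  · have : (((peekSortAux test (d + 3) arr (segStart L p) (segStart L p + 2) (segStart L p)
        (segStart L p + 2)).cost A : ℕ) : ℝ) ≤ 4 := by
      exact_mod_cast hcost.le.trans (by omega)
    push_cast
    linarith

set_option maxHeartbeats 1600000 in
-- The branch in which the run `t` at the midpoint has to be found. The cut is at the end of this
-- run nearer to `m`, so the run belongs to the larger part and the sizes of the two parts differ by
-- at most its length.
theorem rangeBound_mid (hA : IsRunDecomposition A L) (ht : DetectsRuns A L test)
    {arr : List (Fin n)} {d p t q e s m : ℕ}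
    (ih : ∀ (arr : List (Fin n)) (p q e s : ℕ), SingletonsInPlace n L arr → p < q →
      q ≤ L.length → segStart L q - segStart L p ≤ d → Known L p q e s →
      RangeBound A L p q e s (peekSortAux test d arr (segStart L p) (segStart L q - 1) e s))
    (harr : SingletonsInPlace n L arr) (hq : q ≤ L.length) (hn : segStart L q ≤ n)
    (hd : segStart L q - segStart L p ≤ d + 1) (hpq : p + 1 < q)
    (hl : e = segStart L p ∨ e + 1 = segStart L (p + 1))
    (hr : s + 1 = segStart L q ∨ s = segStart L (q - 1))
    (hmid : m = segStart L p + (segStart L q - 1 - segStart L p) / 2)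
    (hret : ¬ (e = segStart L q - 1 ∨ s = segStart L p)) (hm : ¬ m ≤ e) (hs : ¬ s ≤ m)
    (hpt : p ≤ t) (htq : t < q) (hti : segStart L t ≤ m) (htj : m < segStart L (t + 1))
    (hsp : ¬ (q = p + 3 ∧ segStart L q = segStart L p + 3)) :
    RangeBound A L p q e s
      (peekSortAux test (d + 1) arr (segStart L p) (segStart L q - 1) e s) := by
  have hN : segStart L p + 3 ≤ segStart L q := by
    have := segStart_lt hA.pos (show p < q by omega) hq
    have := segStart_lt hA.pos (show p < p + 1 by omega) (by omega)
    have := segStart_lt hA.pos (show q - 1 < q by omega) hq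
    omega
  have hpt' := segStart_mono L hpt
  have htq' := segStart_mono L (show t + 1 ≤ q from htq)
  obtain ⟨hi, hic⟩ := ht.extendRunLeft hpt m hti htj (by omega)
  obtain ⟨hj, hjc⟩ := ht.extendRunRight (t := t) (r := segStart L q - 1) (by omega)
    (by omega) (segStart L q - 1 - m) m (by omega) hti htj
  obtain ⟨i, u, hiu⟩ : ∃ i u, (extendRunLeft test (segStart L p) m).run A = (i, u) := ⟨_, _, rfl⟩
  obtain ⟨j, v, hjv⟩ : ∃ j v, (extendRunRight test (segStart L q - 1 - m) m).run A =
    (j, v) := ⟨_, _, rfl⟩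
  obtain ⟨T, hrun, hcost, hT⟩ := peekSortAux_of_mid (d := d) (arr := arr) (A := A) hmid hret
    hm hs hiu hjv
  rw [hiu] at hi
  rw [hjv] at hj
  obtain rfl : i = segStart L t := hi
  obtain rfl : j = segStart L (t + 1) - 1 := Nat.eq_sub_of_add_eq hj
  have harr' := harr.reverseSlice (t := t) (i := segStart L t) (j := segStart L (t + 1) - 1) rfl
    (by omega) (by omega) (by omega) (u || v)
  have hwhole : ¬ (segStart L t = segStart L p ∧ segStart L (t + 1) - 1 = segStart L q - 1) := by
    rintro ⟨h5, h6⟩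
    rcases hpt.eq_or_lt with rfl | hlt
    · have := segStart_lt hA.pos hpq hq; omega
    · have := segStart_lt hA.pos hlt (by omega); omega
  dsimp only at hT
  generalize (if (u || v) = true then _ else arr) = arr' at harr' hT
  rw [if_neg hwhole] at hT
  have hpt2 : segStart L p < segStart L t ↔ p < t :=
    ⟨fun h => by by_contra hc; rw [show t = p by omega] at h; omega,
      fun h => segStart_lt hA.pos h (by omega)⟩
  have htq2 : segStart L (t + 1) < segStart L q - 1 + 1 ↔ t + 1 < q :=
    ⟨fun h => by by_contra hc; rw [show q = t + 1 by omega] at h; omega,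
      fun h => by have := segStart_lt hA.pos h hq; omega⟩
  clear hret
  rw [if_congr hpt2 rfl rfl] at hic
  rw [if_congr htq2 rfl rfl] at hjc
  -- Because `e < m < s`, the run at the midpoint is neither the known prefix nor the known suffix.
  -- Hence a part consisting of this run alone is never declared known from both sides, as
  -- `Known.one` demands.
  have hel : e = segStart L p ∨ p < t := by
    by_contra hc
    rw [show t = p by omega] at htj
    omega
  have hsr : s + 1 = segStart L q ∨ t + 1 < q := by
    by_contra hc
    rw [show q - 1 = t by omega] at hr
    omega
  by_cases hcut : m - segStart L t < segStart L (t + 1) - 1 - m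
  · rw [if_pos hcut] at hT
    subst hT
    -- The cut is proper: if the run started at the left end and reached farther to the right of `m`
    -- than to the left, it would be the whole range, as `m` is the midpoint rounded down. With ties
    -- going the other way, the same rounding makes the cut on the right proper.
    have hpt1 : p < t := by
      rw [← hpt2]
      by_contra hc
      have : t + 1 < q := htq2.1 (by clear hsp hl hr hel hsr htq2; omega)
      have := segStart_lt hA.pos this hq
      omega
    have hpt3 := hpt2.2 hpt1
    clear hwhole hpt2 htq2
    have r1 := ih _ p t e (segStart L t - 1) harr' hpt1 (by omega) (by omega)
      ⟨by omega, by omega, by omega⟩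
    have r2 := ih _ t q (segStart L (t + 1) - 1) s harr' htq hq (by omega)
      ⟨by omega, by omega, by omega⟩
    refine RangeBound.append_left hA hpt1 htq hq hrun hcost r1 r2
      (by clear hsp hl hr hel hsr; omega) (by clear hsp hl hr hel hsr; omega) ?_ hN hsp
    clear hsp hl hr hel hsr
    rw [if_pos hpt1] at hic
    omega
  · rw [if_neg hcut] at hT
    subst hT
    have htq1 : t + 1 < q := by
      rw [← htq2]
      by_contra hc
      have : p < t := hpt2.1 (by clear hsp hl hr hel hsr htq2 hpt2; omega)
      have := segStart_mono L (show q ≤ t + 1 by omega)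
      omega
    clear hwhole hpt2 htq2
    have htq3 := segStart_lt hA.pos htq1 hq
    rw [show segStart L (t + 1) - 1 + 1 = segStart L (t + 1) by omega] at hrun hcost
    have r1 := ih _ p (t + 1) e (segStart L t) harr' (by omega) (by omega) (by omega)
      ⟨by omega, by simp, by omega⟩
    have r2 := ih _ (t + 1) q (segStart L (t + 1)) s harr' htq1 hq (by omega)
      ⟨by omega, by omega, by omega⟩
    refine RangeBound.append_right hA hpt htq1 hq hrun hcost r1 r2
      (by clear hsp hl hr hel hsr; omega) (by clear hsp hl hr hel hsr; omega) ?_ hN hsp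
    clear hsp hl hr hel hsr
    rw [if_pos htq1] at hjc
    omega

set_option maxHeartbeats 1600000 in
-- Depth at least the size of the range suffices, since both parts of every split are nonempty. The
-- ends of all ranges that occur are boundaries of runs, which allows the induction to be indexed by
-- runs.
theorem rangeBound (hA : IsRunDecomposition A L) (ht : DetectsRuns A L test) (d : ℕ) :
    ∀ (arr : List (Fin n)) (p q e s : ℕ), SingletonsInPlace n L arr → p < q → q ≤ L.length →
      segStart L q - segStart L p ≤ d → Known L p q e s →
      RangeBound A L p q e s (peekSortAux test d arr (segStart L p) (segStart L q - 1) e s) := by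
  induction d with
  | zero =>
    intro arr p q e s _ hpq hq hd _
    have := segStart_lt hA.pos hpq hq
    omega
  | succ d ih =>
    intro arr p q e s harr hpq hq hd hk
    have hadd := fun {i j : ℕ} (h : i ≤ j) (hj : j ≤ q) =>
      segStart_add_le hA.pos h (hj.trans hq)
    have hn : segStart L q ≤ n := by
      rw [← hA.sum, ← segStart_length]; exact segStart_mono L hq
    have hlen := harr.length
    rcases Nat.lt_or_ge (p + 1) q with hpq2 | hpq2
    swap
    · obtain rfl : q = p + 1 := by omega
      exact (rangeBound_single hA ht harr.length hq hd hk).1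
    obtain ⟨hl, hr, -⟩ := hk
    have h0 := hadd hpq.le le_rfl
    have h1 := hadd (i := p) (j := p + 1) (by omega) (by omega)
    have h2 := hadd (i := p + 1) (j := q) (by omega) (by omega)
    have h3 := hadd (i := q - 1) (j := q) (by omega) (by omega)
    have h4 := hadd (i := p) (j := q - 1) (by omega) (by omega)
    have hret : ¬ (e = segStart L q - 1 ∨ s = segStart L p) := by omega
    by_cases hm : segStart L p + (segStart L q - 1 - segStart L p) / 2 ≤ e
    · have he : e + 1 = segStart L (p + 1) := by omega
      rw [peekSortAux_of_mid_le hret hm]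
      have hrec := ih arr (p + 1) q (e + 1) s harr hpq2 hq (by omega) ⟨by omega, by omega, by omega⟩
      rw [he] at hrec ⊢
      exact hrec.cons hA hpq2 hq he (by rw [length_slice (by omega)]; omega) (by omega)
    by_cases hs : s ≤ segStart L p + (segStart L q - 1 - segStart L p) / 2
    · obtain ⟨q, rfl⟩ : ∃ q', q = q' + 1 := ⟨q - 1, by omega⟩
      simp only [Nat.add_sub_cancel] at *
      have hs' : s = segStart L q := by omega
      rw [peekSortAux_of_le_mid hret hm hs]
      have hrec := ih arr p q e (s - 1) harr (by omega) (by omega) (by omega)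
        ⟨by omega, by omega, by omega⟩
      rw [← hs'] at hrec
      exact hrec.snoc hA (by omega) hq hs' (by rw [length_slice (by omega)]; omega) (by omega)
    obtain ⟨t, hpt, htq, hti, htj⟩ := exists_segStart_le_lt (L := L) (p := p) (q := q)
      (m := segStart L p + (segStart L q - 1 - segStart L p) / 2) (by omega) (by omega)
    by_cases hsp : q = p + 3 ∧ segStart L q = segStart L p + 3
    · obtain ⟨rfl, hsp⟩ := hsp
      have := rangeBound_three hA ht harr hq hsp (show 3 ≤ d + 1 by omega)
      have he : e = segStart L p := by omega
      have hs' : s = segStart L p + 2 := by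
        have := hadd (i := p + 1) (j := p + 2) (by omega) (by omega)
        rcases hr with hr | hr
        · omega
        · simp only [show p + 3 - 1 = p + 2 by omega] at *; omega
      rwa [hsp, show segStart L p + 3 - 1 = segStart L p + 2 by omega, he, hs']
    exact rangeBound_mid hA ht ih harr hq hn hd hpq2 hl hr rfl hret hm hs hpt htq hti htj hsp

end

/-! ### Entropy of the run lengths -/

/-- The weights `l / n` sum to one, so the `log₂ n` terms collect into `n log₂ n`. Every entropy
estimate below uses this form. -/
theorem runEntropy_mul_sum {L : List ℕ} (hL : ∀ l ∈ L, 0 < l) :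
    runEntropy L * (L.sum : ℝ) =
      mulLogb (L.sum : ℝ) - (L.map fun l : ℕ => mulLogb (l : ℝ)).sum := by
  rcases L.eq_nil_or_concat with rfl | ⟨L', a, hLa⟩
  · simp [runEntropy, shannonEntropy, mulLogb]
  have hN : 0 < L.sum := by
    have := hL a (by simp [hLa])
    rw [hLa]; simp; omega
  have hN' : (0 : ℝ) < L.sum := by exact_mod_cast hN
  -- The list is generalized while the normalizing total stays `L.sum`, so that induction is
  -- possible.
  have key : ∀ M : List ℕ, (∀ l ∈ M, 0 < l) →
      (M.map fun l : ℕ => (l : ℝ) / (L.sum : ℝ) * Real.logb 2 (1 / ((l : ℝ) / (L.sum : ℝ)))).sum *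
        (L.sum : ℝ) = (M.sum : ℝ) * Real.logb 2 (L.sum : ℝ) -
          (M.map fun l : ℕ => mulLogb (l : ℝ)).sum := by
    intro M hM
    induction M with
    | nil => simp
    | cons l M ih =>
      have hl : (0 : ℝ) < l := by exact_mod_cast hM l (by simp)
      have ih := ih fun x hx => hM x (by simp [hx])
      simp only [List.map_cons, List.sum_cons, add_mul, ih, Nat.cast_add]
      rw [one_div_div, Real.logb_div hN'.ne' hl.ne', mulLogb]
      field_simp
      ring
  have := key L hL
  simp only [runEntropy, shannonEntropy, bind_pure_comp, List.map_eq_map, List.map_map]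
  exact this

theorem runWeight_eq_sum_take (L : List ℕ) {k : ℕ} (hk : k ≤ L.length) :
    runWeight L 0 k = ((L.take k).map fun l : ℕ => mulLogb (l : ℝ)).sum := by
  induction k with
  | zero => simp [runWeight]
  | succ k ih =>
    rw [runWeight_append L (Nat.zero_le k) (Nat.le_succ k), ih (by omega), runWeight_single,
      segStart_succ hk, Nat.add_sub_cancel_left, ← List.take_concat_get' L k hk,
      List.map_append, List.sum_append]
    simp only [List.map_cons, List.map_nil, List.sum_cons, List.sum_nil, add_zero]

theorem runEntropy_mul {L : List ℕ} (hL : ∀ l ∈ L, 0 < l) :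
    runEntropy L * (L.sum : ℝ) = mulLogb (L.sum : ℝ) - runWeight L 0 L.length := by
  rw [runEntropy_mul_sum hL, runWeight_eq_sum_take L le_rfl, List.take_length]

/-! ### Upper bounds for PeekSort -/

section

variable {α : Type*} [LinearOrder α] {n : ℕ} {A : Fin n → α} {L : List ℕ}
  {test : ℕ → CompTree (Fin n) ScanStep}

theorem rangeBound_peekSort (hA : IsRunDecomposition A L) (ht : DetectsRuns A L test)
    (hn : 1 ≤ n) : RangeBound A L 0 L.length 0 (n - 1) (peekSort n test) := by
  have hS : segStart L L.length = n := by rw [segStart_length, hA.sum]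
  have hlen : 0 < L.length := by
    by_contra hc
    rw [show L.length = 0 by omega, segStart_zero] at hS
    omega
  have := rangeBound hA ht n (List.finRange n) 0 L.length 0 (n - 1)
    (SingletonsInPlace.finRange n L) hlen le_rfl (by omega)
    ⟨Or.inl rfl, by omega, fun _ => Or.inl rfl⟩
  rwa [hS, segStart_zero] at this

theorem peekSort_mergeCost_le (hA : IsRunDecomposition A L) (ht : DetectsRuns A L test)
    (h : 3 ≤ n ∨ 2 ≤ L.length) :
    (((peekSort n test).run A).2 : ℝ) ≤
      runEntropy L * (n : ℝ) + 2 * (n : ℝ) - ((L.length : ℝ) + 2) := by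
  have hS : segStart L L.length = n := by rw [segStart_length, hA.sum]
  have hle := segStart_add_le hA.pos (Nat.zero_le L.length) le_rfl
  rw [segStart_zero] at hle
  have hn : 1 ≤ n := by omega
  have hE := runEntropy_mul hA.pos
  rw [hA.sum] at hE
  have hb := (rangeBound_peekSort hA ht hn).bound.merge
  rw [hS, segStart_zero] at hb
  simp only [Nat.sub_zero, Nat.sub_self, Nat.cast_zero] at hb
  rcases Nat.lt_or_ge L.length 2 with hlt | hge
  · have h1 : L.length = 1 := by
      rcases Nat.eq_zero_or_pos L.length with h0 | h0
      · rw [h0, segStart_zero] at hS; omega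
      · omega
    have hS1 : segStart L 1 = n := by rw [← h1, hS]
    have h3 : (3 : ℝ) ≤ n := by exact_mod_cast (show 3 ≤ n by omega)
    -- For one run the amortized bound gives only `2 * n - 2`; the claim holds because no merge
    -- takes place when `n ≥ 3`.
    have hz := (rangeBound_single hA ht (d := n) (p := 0) (e := 0) (s := n - 1)
      (List.length_finRange (n := n)) (by omega) (by rw [zero_add, hS1]; omega)
      ⟨Or.inl rfl, by rw [zero_add, hS1]; omega, fun _ => Or.inl rfl⟩).2
      (by rw [zero_add, hS1, segStart_zero]; omega)
    rw [zero_add, hS1, segStart_zero] at hz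
    rw [peekSort, hz, hE, h1, runWeight_single L 0, zero_add, hS1, segStart_zero, Nat.sub_zero]
    push_cast
    linarith
  · rw [if_neg (by omega)] at hb
    linarith

theorem peekSort_cost_le (hA : IsRunDecomposition A L) (ht : DetectsRuns A L test) (hn : 2 ≤ n) :
    ((peekSort n test).cost A : ℝ) ≤
      runEntropy L * (n : ℝ) + 3 * (n : ℝ) - (2 * (L.length : ℝ) + 3) := by
  have hS : segStart L L.length = n := by rw [segStart_length, hA.sum]
  have hE := runEntropy_mul hA.pos
  rw [hA.sum] at hE
  have hb := (rangeBound_peekSort hA ht (by omega)).bound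
  rw [hS, segStart_zero, Nat.sub_zero, Nat.sub_zero, Nat.sub_self] at hb
  rcases Nat.lt_or_ge L.length 2 with hlt | hge
  · have h1 : L.length = 1 := by
      rcases Nat.eq_zero_or_pos L.length with h0 | h0
      · rw [h0, segStart_zero] at hS; omega
      · omega
    rw [h1] at hb hE ⊢
    have h3 : (2 : ℝ) ≤ n := by exact_mod_cast hn
    have e1 := hb.comp_one_cast
    have e2 := hb.entropy_one rfl
    push_cast at *
    linarith
  · have := hb.comp hge
    push_cast at *
    linarith

end

/-! ### The lower bound for merge trees -/

namespace MergeTree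

theorem sum_leaves (t : MergeTree) : t.leaves.sum = t.size := by
  induction t with
  | leaf len => simp [leaves, size]
  | node t u iht ihu => simp [leaves, size, iht, ihu]

theorem size_pos {t : MergeTree} (ht : ∀ l ∈ t.leaves, 0 < l) : 0 < t.size := by
  induction t with
  | leaf len => exact ht len (by simp [leaves])
  | node t u iht ihu =>
    have := iht fun l hl => ht l (by simp [leaves, hl])
    simp only [size]
    omega

/-- At each inner node the merge cost dominates the increase of `x log₂ x`, because binary entropy
is at most one. -/
theorem mulLogb_size_le {t : MergeTree} (ht : ∀ l ∈ t.leaves, 0 < l) :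
    mulLogb (t.size : ℝ) ≤
      t.mergeCost + (t.leaves.map fun l : ℕ => mulLogb (l : ℝ)).sum := by
  induction t with
  | leaf len => simp [leaves, size, mergeCost]
  | node t u iht ihu =>
    have h1 : ∀ l ∈ t.leaves, 0 < l := fun l hl => ht l (by simp [leaves, hl])
    have h2 : ∀ l ∈ u.leaves, 0 < l := fun l hl => ht l (by simp [leaves, hl])
    have := mulLogb_add_le (a := t.size) (b := u.size) (by exact_mod_cast size_pos h1)
      (by exact_mod_cast size_pos h2)
    have iht := iht h1
    have ihu := ihu h2
    simp only [leaves, size, mergeCost, List.map_append, List.sum_append]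
    push_cast
    linarith

theorem runEntropy_mul_le_mergeCost {L : List ℕ} {t : MergeTree} (hL : ∀ l ∈ L, 0 < l)
    (h : t.leaves.Perm L) : runEntropy L * (L.sum : ℝ) ≤ (t.mergeCost : ℝ) := by
  have := mulLogb_size_le (t := t) fun l hl => hL l (h.mem_iff.1 hl)
  rw [← sum_leaves, h.sum_eq, (h.map _).sum_eq] at this
  rw [runEntropy_mul_sum hL]
  linarith

end MergeTree

/-! ### The information-theoretic lower bound -/

/-- On inputs that cost at most `c` comparisons, at most `2 ^ c` different results occur. -/
theorem card_image_run_le {ι β X : Type} [DecidableEq β] (T : CompTree ι β) (input : X → ι → ℕ)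
    (c : ℕ) (s : Finset X) (h : ∀ x ∈ s, T.cost (input x) ≤ c) :
    (s.image fun x => T.run (input x)).card ≤ 2 ^ c := by
  induction T generalizing c s with
  | ret b =>
    refine le_trans ?_ Nat.one_le_two_pow
    refine Finset.card_le_one.2 fun a ha b hb => ?_
    simp only [run, Finset.mem_image] at ha hb
    obtain ⟨_, _, rfl⟩ := ha
    obtain ⟨_, _, rfl⟩ := hb
    rfl
  | ask x y k ih =>
    rcases s.eq_empty_or_nonempty with rfl | ⟨x₀, hx₀⟩
    · simp
    obtain ⟨c, rfl⟩ : ∃ c', c = c' + 1 := by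
      have := h x₀ hx₀
      simp only [cost] at this
      exact ⟨c - 1, by omega⟩
    have key : ∀ b, ((s.filter fun z => decide (input z x ≤ input z y) = b).image
        fun z => (k b).run (input z)).card ≤ 2 ^ c := by
      intro b
      refine ih b c _ fun z hz => ?_
      obtain ⟨hz, hb⟩ := Finset.mem_filter.1 hz
      have := h z hz
      simp only [cost, hb] at this
      omega
    have hsub : (s.image fun z => (ask x y k).run (input z)) ⊆
        ((s.filter fun z => decide (input z x ≤ input z y) = true).image
          fun z => (k true).run (input z)) ∪
        ((s.filter fun z => decide (input z x ≤ input z y) = false).image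
          fun z => (k false).run (input z)) := by
      intro b hb
      obtain ⟨z, hz, rfl⟩ := Finset.mem_image.1 hb
      rw [Finset.mem_union, Finset.mem_image, Finset.mem_image]
      rcases hd : decide (input z x ≤ input z y) with _ | _
      · exact Or.inr ⟨z, Finset.mem_filter.2 ⟨hz, hd⟩, by simp only [run, hd]⟩
      · exact Or.inl ⟨z, Finset.mem_filter.2 ⟨hz, hd⟩, by simp only [run, hd]⟩
    calc _ ≤ _ := Finset.card_le_card hsub
      _ ≤ 2 ^ c + 2 ^ c := (Finset.card_union_le _ _).trans (Nat.add_le_add (key _) (key _))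
      _ = 2 ^ (c + 1) := by ring

/-- A permutation as an array of distinct natural numbers. -/
def permArray {n : ℕ} (σ : Equiv.Perm (Fin n)) (x : Fin n) : ℕ := σ x

theorem permArray_injective {n : ℕ} (σ : Equiv.Perm (Fin n)) :
    Function.Injective (permArray σ) := fun _ _ h => σ.injective (Fin.ext h)

/-- Reading either permutation along the common output gives the sorted list of the same values `0,
…, n - 1`, so the two agree at every position. -/
theorem eq_of_sortsInput_of_run_eq {n : ℕ} {T : CompTree (Fin n) (List (Fin n))}
    {σ τ : Equiv.Perm (Fin n)} (hσ : SortsInput T (permArray σ)) (hτ : SortsInput T (permArray τ))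
    (h : T.run (permArray σ) = T.run (permArray τ)) : σ = τ := by
  obtain ⟨h1, h2⟩ := hσ
  obtain ⟨h3, h4⟩ := hτ
  rw [← h] at h4
  have hperm : ∀ ρ : Equiv.Perm (Fin n),
      ((List.finRange n).map (permArray ρ)).Perm ((List.finRange n).map Fin.val) := by
    intro ρ
    have : (List.finRange n).map (permArray ρ) = ((List.finRange n).map ρ).map Fin.val := by
      simp [permArray, Function.comp_def]
    rw [this]
    refine List.Perm.map _ ((List.perm_ext_iff_of_nodup
      ((List.nodup_finRange n).map ρ.injective) (List.nodup_finRange n)).2 fun a => ?_)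
    simp only [List.mem_map, List.mem_finRange, true_and, iff_true]
    exact ρ.surjective a
  have heq := List.Perm.eq_of_pairwise' h2 h4
    (((h1.map _).trans (hperm σ)).trans ((h1.map _).trans (hperm τ)).symm)
  ext x
  exact List.map_inj_left.1 heq x (h1.mem_iff.2 (List.mem_finRange x))

theorem exists_logb_card_le_cost {n : ℕ} (T : CompTree (Fin n) (List (Fin n)))
    (s : Finset (Equiv.Perm (Fin n))) (hs : s.Nonempty)
    (hT : ∀ σ ∈ s, SortsInput T (permArray σ)) :
    ∃ σ ∈ s, Real.logb 2 s.card ≤ T.cost (permArray σ) := by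
  obtain ⟨σ, hσ, hmax⟩ := s.exists_max_image (fun σ => T.cost (permArray σ)) hs
  refine ⟨σ, hσ, ?_⟩
  have h1 := card_image_run_le T permArray _ s hmax
  rw [Finset.card_image_of_injOn fun σ hσ τ hτ h =>
    eq_of_sortsInput_of_run_eq (hT σ hσ) (hT τ hτ) h] at h1
  have h2 : (s.card : ℝ) ≤ 2 ^ T.cost (permArray σ) := by exact_mod_cast h1
  have h3 : (0 : ℝ) < s.card := by exact_mod_cast hs.card_pos
  calc Real.logb 2 s.card ≤ Real.logb 2 (2 ^ T.cost (permArray σ)) :=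
        Real.logb_le_logb_of_le one_lt_two h3 h2
    _ = T.cost (permArray σ) := by rw [Real.logb_pow]; simp

/-! ### Counting arrays of sorted segments -/

section

variable {n : ℕ} (seg : Fin n → ℕ)

/-- The permutations that increase on the classes of `seg`. -/
noncomputable def sortedPerms : Finset (Equiv.Perm (Fin n)) :=
  open Classical in Finset.univ.filter fun σ => ∀ x y, seg x = seg y → x < y → σ x < σ y

/-- The permutations that increase on the classes of `seg` and have a descent between any two
consecutive classes. -/
noncomputable def maximalPerms : Finset (Equiv.Perm (Fin n)) :=
  open Classical in (sortedPerms seg).filter fun σ =>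
    ∀ x y : Fin n, (x : ℕ) + 1 = y → seg x ≠ seg y → σ y < σ x

variable {seg}

theorem mem_sortedPerms {σ : Equiv.Perm (Fin n)} :
    σ ∈ sortedPerms seg ↔ ∀ x y, seg x = seg y → x < y → σ x < σ y := by
  simp [sortedPerms]

theorem mem_maximalPerms {σ : Equiv.Perm (Fin n)} :
    σ ∈ maximalPerms seg ↔ σ ∈ sortedPerms seg ∧
      ∀ x y : Fin n, (x : ℕ) + 1 = y → seg x ≠ seg y → σ y < σ x := by
  simp [maximalPerms]

/-- A permutation is determined by the sorted permutation obtained by sorting its segments and by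
the way in which the segments are permuted. -/
theorem factorial_le_card_sortedPerms_mul (hseg : Monotone seg) :
    n.factorial ≤ (sortedPerms seg).card * ∏ x, (Finset.univ.filter fun y => seg y = seg x).card := by
  have hτ : ∀ σ : Equiv.Perm (Fin n), ∃ τ : Equiv.Perm (Fin n),
      (∀ x, seg (τ x) = seg x) ∧ σ * τ ∈ sortedPerms seg := by
    intro σ
    let f : Fin n → ℕ ×ₗ Fin n := fun x => toLex (seg x, σ x)
    have hf := Tuple.monotone_sort f
    have h1 : Monotone (seg ∘ Tuple.sort f) := fun x y hxy => by
      have := hf hxy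
      rcases Prod.Lex.le_iff.1 this with h | h
      · exact h.le
      · exact h.1.le
    -- Sorting by the class first makes `seg` monotone again, and a monotone function has only one
    -- monotone rearrangement. So the sorting permutation preserves every class.
    have h2 : seg ∘ Tuple.sort f = seg := Tuple.unique_monotone (τ := 1) h1 hseg
    refine ⟨Tuple.sort f, fun x => congrFun h2 x, mem_sortedPerms.2 fun x y hs hxy => ?_⟩
    rcases Prod.Lex.le_iff.1 (hf hxy.le) with h | h
    · have e1 := congrFun h2 x
      have e2 := congrFun h2 y
      simp only [Function.comp_apply] at e1 e2
      have h : seg (Tuple.sort f x) < seg (Tuple.sort f y) := h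
      omega
    · refine lt_of_le_of_ne h.2 fun he => hxy.ne ?_
      exact (Tuple.sort f).injective (σ.injective he)
  choose τ h1 h2 using hτ
  -- The permutation `τ σ` is recorded merely as a choice of one class member for every position.
  -- This gives `m ^ m` instead of `m !` for a class of size `m`, and the logarithm is exactly `m
  -- log₂ m`.
  let F : Equiv.Perm (Fin n) → sortedPerms seg × ((x : Fin n) → {y // seg y = seg x}) :=
    fun σ => (⟨σ * τ σ, h2 σ⟩, fun x => ⟨τ σ x, h1 σ x⟩)
  have hF : Function.Injective F := by
    intro σ ρ h
    have e1 : σ * τ σ = ρ * τ ρ := congrArg Subtype.val (congrArg Prod.fst h)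
    have e2 : τ σ = τ ρ := Equiv.ext fun x =>
      congrArg Subtype.val (congrFun (congrArg Prod.snd h) x)
    rw [e2] at e1
    exact mul_right_cancel e1
  have := Fintype.card_le_of_injective F hF
  rw [Fintype.card_perm, Fintype.card_fin, Fintype.card_prod, Fintype.card_coe, Fintype.card_pi]
    at this
  simpa only [Fintype.card_subtype] using this

/-- Swapping the neighbours at a set of boundaries, no two of which are adjacent. -/
theorem exists_perm_swap (F : Finset (Fin n)) (h : ∀ x ∈ F, ∃ y : Fin n, (x : ℕ) + 1 = y ∧ y ∉ F) :
    ∃ π : Equiv.Perm (Fin n), (∀ x y : Fin n, (x : ℕ) + 1 = y → x ∈ F → π x = y ∧ π y = x) ∧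
      ∀ y : Fin n, y ∉ F → (∀ x : Fin n, (x : ℕ) + 1 = y → x ∉ F) → π y = y := by
  classical
  have hp : ∀ x : Fin n, ∃ z : Fin n, (x ∈ F ∧ (x : ℕ) + 1 = z) ∨ (z ∈ F ∧ (z : ℕ) + 1 = x) ∨
      (x ∉ F ∧ (∀ z : Fin n, (z : ℕ) + 1 = x → z ∉ F) ∧ z = x) := by
    intro x
    by_cases hx : x ∈ F
    · obtain ⟨y, hy, -⟩ := h x hx
      exact ⟨y, Or.inl ⟨hx, hy⟩⟩
    · by_cases hz : ∃ z : Fin n, (z : ℕ) + 1 = x ∧ z ∈ F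
      · obtain ⟨z, hz1, hz2⟩ := hz
        exact ⟨z, Or.inr (Or.inl ⟨hz2, hz1⟩)⟩
      · exact ⟨x, Or.inr (Or.inr ⟨hx, fun z h1 h2 => hz ⟨z, h1, h2⟩, rfl⟩)⟩
  have hsucc : ∀ x y : Fin n, x ∈ F → (x : ℕ) + 1 = y → y ∉ F := by
    intro x y hx hxy
    obtain ⟨y', hy', hy⟩ := h x hx
    rwa [show y = y' from Fin.ext (by omega)]
  choose p hp using hp
  have hup : ∀ x y : Fin n, (x : ℕ) + 1 = y → x ∈ F → p x = y := by
    intro x y hxy hx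
    rcases hp x with h1 | h1 | h1
    · exact Fin.ext (by omega)
    · exact absurd hx (hsucc _ _ h1.1 h1.2)
    · exact absurd hx h1.1
  have hdown : ∀ x y : Fin n, (x : ℕ) + 1 = y → x ∈ F → p y = x := by
    intro x y hxy hx
    rcases hp y with h1 | h1 | h1
    · exact absurd h1.1 (hsucc _ _ hx hxy)
    · exact Fin.ext (by omega)
    · exact absurd hx (h1.2.1 x hxy)
  have hinv : Function.Involutive p := by
    intro x
    rcases hp x with h1 | h1 | h1
    · exact hdown x _ h1.2 h1.1
    · exact hup _ x h1.2 h1.1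
    · rw [h1.2.2, h1.2.2]
  refine ⟨hinv.toPerm, fun x y hxy hx => ⟨hup x y hxy hx, hdown x y hxy hx⟩, fun y hy hx => ?_⟩
  rcases hp y with h1 | h1 | h1
  · exact absurd h1.1 hy
  · exact absurd h1.1 (hx _ h1.2)
  · exact h1.2.2

/-- Exchange the two entries at each boundary that is an ascent. Boundaries are never adjacent, so
the exchanges are disjoint, and the set `F σ` of exchanged boundaries allows `σ` to be recovered.
There are at most `2 ^ n` such sets. -/
theorem card_sortedPerms_le (hseg : Monotone seg)
    (hadj : ∀ x y z : Fin n, (x : ℕ) + 1 = y → (y : ℕ) + 1 = z → seg x ≠ seg y → seg y = seg z) :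
    (sortedPerms seg).card ≤ (maximalPerms seg).card * 2 ^ n := by
  classical
  let F : Equiv.Perm (Fin n) → Finset (Fin n) := fun σ => Finset.univ.filter fun x =>
    ∃ y : Fin n, (x : ℕ) + 1 = y ∧ seg x ≠ seg y ∧ σ x < σ y
  have hFm : ∀ σ x, x ∈ F σ ↔ ∃ y : Fin n, (x : ℕ) + 1 = y ∧ seg x ≠ seg y ∧ σ x < σ y := by
    intro σ x; simp [F]
  have hF : ∀ σ, ∀ x ∈ F σ, ∃ y : Fin n, (x : ℕ) + 1 = y ∧ y ∉ F σ := by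
    intro σ x hx
    obtain ⟨y, hy, hne, -⟩ := (hFm σ x).1 hx
    refine ⟨y, hy, fun hyF => ?_⟩
    obtain ⟨z, hz, hne', -⟩ := (hFm σ y).1 hyF
    exact hne' (hadj x y z hy hz hne)
  have hP : ∀ G : Finset (Fin n), ∃ π : Equiv.Perm (Fin n),
      (∀ x ∈ G, ∃ y : Fin n, (x : ℕ) + 1 = y ∧ y ∉ G) →
      (∀ x y : Fin n, (x : ℕ) + 1 = y → x ∈ G → π x = y ∧ π y = x) ∧
      ∀ y : Fin n, y ∉ G → (∀ x : Fin n, (x : ℕ) + 1 = y → x ∉ G) → π y = y := by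
    intro G
    by_cases hG : ∀ x ∈ G, ∃ y : Fin n, (x : ℕ) + 1 = y ∧ y ∉ G
    · obtain ⟨π, hπ⟩ := exists_perm_swap G hG
      exact ⟨π, fun _ => hπ⟩
    · exact ⟨1, fun h => absurd h hG⟩
  choose π hπ using hP
  have hcard : ((maximalPerms seg) ×ˢ (Finset.univ : Finset (Finset (Fin n)))).card =
      (maximalPerms seg).card * 2 ^ n := by
    rw [Finset.card_product, Finset.card_univ, Fintype.card_finset, Fintype.card_fin]
  rw [← hcard]
  refine Finset.card_le_card_of_injOn (fun σ => (σ * π (F σ), F σ)) ?_ ?_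
  · intro σ hσ
    obtain ⟨hswap, hfix⟩ := hπ (F σ) (hF σ)
    have hσ := mem_sortedPerms.1 hσ
    simp only [Finset.coe_product, Set.mem_prod, Finset.mem_coe, Finset.mem_univ, and_true]
    rw [mem_maximalPerms, mem_sortedPerms]
    -- An exchange raises only the last entry of a class and lowers only the first entry of a class.
    -- So entries that are not last do not grow, and by `hge` entries that are not first do not
    -- shrink; the order inside classes survives.
    have hle : ∀ x y : Fin n, (x : ℕ) + 1 = y → seg x = seg y → σ (π (F σ) x) ≤ σ x := by
      intro x y hxy hs
      have hx : x ∉ F σ := fun hx => by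
        obtain ⟨y', hy', hne, -⟩ := (hFm σ x).1 hx
        exact hne (by rw [hs, show y = y' from Fin.ext (by omega)])
      by_cases hz : ∃ z : Fin n, (z : ℕ) + 1 = x ∧ z ∈ F σ
      · obtain ⟨z, hz1, hz2⟩ := hz
        obtain ⟨x', hx', -, hlt⟩ := (hFm σ z).1 hz2
        rw [(hswap z x hz1 hz2).2]
        rw [show x = x' from Fin.ext (by omega)]
        exact hlt.le
      · rw [hfix x hx fun z h1 h2 => hz ⟨z, h1, h2⟩]
    have hge : ∀ x y : Fin n, (x : ℕ) + 1 = y → seg x = seg y → σ y ≤ σ (π (F σ) y) := by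
      intro x y hxy hs
      have hx : x ∉ F σ := fun hx => by
        obtain ⟨y', hy', hne, -⟩ := (hFm σ x).1 hx
        exact hne (by rw [hs, show y = y' from Fin.ext (by omega)])
      by_cases hy : y ∈ F σ
      · obtain ⟨z, hz, -, hlt⟩ := (hFm σ y).1 hy
        rw [(hswap y z hz hy).1]
        exact hlt.le
      · rw [hfix y hy fun z hz => by rwa [show z = x from Fin.ext (by omega)]]
    refine ⟨fun x y hs hxy => ?_, fun x y hxy hne => ?_⟩
    · have hxy' : (x : ℕ) < y := hxy
      have e1 := hle x ⟨x + 1, by omega⟩ rfl (le_antisymm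
        (hseg (Fin.le_def.2 (by simp))) (by rw [hs]; exact hseg (Fin.le_def.2 (by simp; omega))))
      have e2 := hge ⟨y - 1, by omega⟩ y (by simp only; omega) (le_antisymm
        (hseg (Fin.le_def.2 (by simp))) (by rw [← hs]; exact hseg (Fin.le_def.2 (by simp; omega))))
      exact (e1.trans_lt (hσ x y hs hxy)).trans_le e2
    · change σ (π (F σ) y) < σ (π (F σ) x)
      by_cases hx : x ∈ F σ
      · obtain ⟨y', hy', -, hlt⟩ := (hFm σ x).1 hx
        rw [(hswap x y hxy hx).1, (hswap x y hxy hx).2]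
        rwa [show y = y' from Fin.ext (by omega)]
      · have hyF : y ∉ F σ := fun hy => by
          obtain ⟨z, hz, hne', -⟩ := (hFm σ y).1 hy
          exact hne' (hadj x y z hxy hz hne)
        rw [hfix y hyF fun z hz => by rwa [show z = x from Fin.ext (by omega)],
          hfix x hx fun z hz hzF => ?_]
        · refine lt_of_not_ge fun hc => hx ((hFm σ x).2 ⟨y, hxy, hne, lt_of_le_of_ne hc fun he => ?_⟩)
          exact hne (by rw [σ.injective he])
        · obtain ⟨x', hx', hne', -⟩ := (hFm σ z).1 hzF
          obtain rfl : x' = x := Fin.ext (by omega)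
          exact hne (hadj z x' y hz hxy hne')
  · intro σ _ ρ _ h
    have e2 : F σ = F ρ := congrArg Prod.snd h
    have e1 : σ * π (F σ) = ρ * π (F ρ) := congrArg Prod.fst h
    rw [e2] at e1
    exact mul_right_cancel e1

end

/-! ### The lower bounds for sorting -/

section

variable {n : ℕ} {L : List ℕ} {seg : Fin n → ℕ}

/-- `seg x` is the segment that contains the position `x`. -/
def IsSegmentIndex (L : List ℕ) (seg : Fin n → ℕ) : Prop :=
  ∀ x, seg x < L.length ∧ segStart L (seg x) ≤ x ∧ (x : ℕ) < segStart L (seg x + 1)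

theorem exists_isSegmentIndex (hsum : L.sum = n) :
    ∃ seg : Fin n → ℕ, IsSegmentIndex L seg := by
  have h : ∀ x : Fin n, ∃ t, t < L.length ∧ segStart L t ≤ x ∧ (x : ℕ) < segStart L (t + 1) := by
    intro x
    obtain ⟨t, -, h1, h2⟩ := exists_segStart_le_lt (L := L) (p := 0) (q := L.length) (m := x)
      (by simp [segStart_zero]) (by rw [segStart_length, hsum]; exact x.2)
    exact ⟨t, h1, h2⟩
  choose seg h using h
  exact ⟨seg, h⟩

namespace IsSegmentIndex

theorem eq_of_mem (h : IsSegmentIndex L seg) {x : Fin n} {i : ℕ} (h1 : segStart L i ≤ x)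
    (h2 : (x : ℕ) < segStart L (i + 1)) : seg x = i := by
  obtain ⟨-, h3, h4⟩ := h x
  rcases lt_trichotomy (seg x) i with hlt | heq | hlt
  · have := segStart_mono L (show seg x + 1 ≤ i from hlt); omega
  · exact heq
  · have := segStart_mono L (show i + 1 ≤ seg x from hlt); omega

theorem monotone (h : IsSegmentIndex L seg) : Monotone seg := by
  intro x y hxy
  by_contra hc
  have := segStart_mono L (show seg y + 1 ≤ seg x by omega)
  have h1 := (h x).2.1
  have h2 := (h y).2.2
  have : (x : ℕ) ≤ y := hxy
  omega

theorem card_filter (h : IsSegmentIndex L seg) (i : ℕ) :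
    (Finset.univ.filter fun y => seg y = i).card ≤ segStart L (i + 1) - segStart L i := by
  rw [← Nat.card_Ico, ← Finset.card_map Fin.valEmbedding]
  refine Finset.card_le_card fun k hk => ?_
  simp only [Finset.mem_map, Finset.mem_filter, Finset.mem_univ, true_and] at hk
  obtain ⟨x, rfl, rfl⟩ := hk
  exact Finset.mem_Ico.2 (h x).2

/-- Grouped by classes, a class of size `m` contributes `m` copies of `log₂ m`. -/
theorem sum_logb_card_le (h : IsSegmentIndex L seg) :
    ∑ x, Real.logb 2 ((Finset.univ.filter fun y => seg y = seg x).card : ℝ) ≤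
      runWeight L 0 L.length := by
  rw [← Finset.sum_fiberwise_of_maps_to (s := Finset.univ) (t := Finset.Ico 0 L.length) (g := seg)
    fun x _ => Finset.mem_Ico.2 ⟨Nat.zero_le _, (h x).1⟩]
  refine Finset.sum_le_sum fun i _ => ?_
  have h1 : ∑ x ∈ Finset.univ.filter (fun y => seg y = i),
      Real.logb 2 ((Finset.univ.filter fun y => seg y = seg x).card : ℝ) =
      mulLogb ((Finset.univ.filter fun y => seg y = i).card : ℝ) := by
    rw [mulLogb, ← nsmul_eq_mul]
    refine Finset.sum_eq_card_nsmul fun x hx => ?_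
    rw [(Finset.mem_filter.1 hx).2]
  rw [h1]
  have h2 := h.card_filter i
  rcases Nat.eq_zero_or_pos (Finset.univ.filter fun y => seg y = i).card with h0 | h0
  · rw [h0]
    simp only [mulLogb, Nat.cast_zero, zero_mul]
    rcases Nat.eq_zero_or_pos (segStart L (i + 1) - segStart L i) with h3 | h3
    · simp [h3]
    · exact mul_nonneg (Nat.cast_nonneg _)
        (Real.logb_nonneg one_lt_two (by exact_mod_cast h3))
  · have h3 : (1 : ℝ) ≤ (Finset.univ.filter fun y => seg y = i).card := by exact_mod_cast h0
    have h4 : ((Finset.univ.filter fun y => seg y = i).card : ℝ) ≤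
      ((segStart L (i + 1) - segStart L i : ℕ) : ℝ) := by exact_mod_cast h2
    exact mul_le_mul h4 (Real.logb_le_logb_of_le one_lt_two (by linarith) h4)
      (Real.logb_nonneg one_lt_two h3) (Nat.cast_nonneg _)

theorem runEntropy_mul_le (h : IsSegmentIndex L seg) (hL : ∀ l ∈ L, 0 < l) (hsum : L.sum = n) :
    runEntropy L * (n : ℝ) ≤
      Real.logb 2 ((sortedPerms seg).card : ℝ) + Real.logb 2 (Real.exp 1) * n := by
  have hE := runEntropy_mul hL
  rw [hsum] at hE
  have h1 := factorial_le_card_sortedPerms_mul h.monotone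
  have h2 := h.sum_logb_card_le
  have hpos : ∀ x : Fin n, (0 : ℝ) < (Finset.univ.filter fun y => seg y = seg x).card := by
    intro x
    exact_mod_cast Finset.card_pos.2 ⟨x, by simp⟩
  have hfac : (0 : ℝ) < n.factorial := by exact_mod_cast n.factorial_pos
  have hprod : (0 : ℝ) < ∏ x : Fin n, ((Finset.univ.filter fun y => seg y = seg x).card : ℝ) :=
    Finset.prod_pos fun x _ => hpos x
  have h3 : (n.factorial : ℝ) ≤ (sortedPerms seg).card *
      ∏ x : Fin n, ((Finset.univ.filter fun y => seg y = seg x).card : ℝ) := by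
    exact_mod_cast h1
  have hcard : (0 : ℝ) < (sortedPerms seg).card := by
    by_contra hc
    have := mul_nonpos_of_nonpos_of_nonneg (not_lt.1 hc) hprod.le
    linarith
  have h4 := Real.logb_le_logb_of_le one_lt_two hfac h3
  rw [Real.logb_mul hcard.ne' hprod.ne', Real.logb_prod _ _ fun x _ => (hpos x).ne'] at h4
  -- This is `n ^ n / n ! ≤ e ^ n`, one term of the exponential series.
  have h5 : mulLogb n ≤ Real.logb 2 n.factorial + Real.logb 2 (Real.exp 1) * n := by
    rcases Nat.eq_zero_or_pos n with rfl | hn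
    · simp [mulLogb]
    have hn' : (0 : ℝ) < n := by exact_mod_cast hn
    have := Real.pow_div_factorial_le_exp (x := n) hn'.le n
    rw [div_le_iff₀ hfac] at this
    have := Real.logb_le_logb_of_le one_lt_two (by positivity) this
    rw [Real.logb_pow, Real.logb_mul (Real.exp_pos _).ne' hfac.ne'] at this
    have he : Real.logb 2 (Real.exp n) = Real.logb 2 (Real.exp 1) * n := by
      rw [Real.logb, Real.logb, Real.log_exp, Real.log_exp]
      ring
    rw [mulLogb]
    linarith
  linarith

theorem increasingSegments (h : IsSegmentIndex L seg) (hL : ∀ l ∈ L, 0 < l) (hsum : L.sum = n)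
    {σ : Equiv.Perm (Fin n)} (hσ : σ ∈ sortedPerms seg) :
    IncreasingSegments (permArray σ) L := by
  refine ⟨hL, hsum, fun i _ x y hx hxy hy => ?_⟩
  have hxy' : (x : ℕ) < y := hxy
  refine (mem_sortedPerms.1 hσ x y ?_ hxy).le
  rw [h.eq_of_mem hx (by omega), h.eq_of_mem (by omega) hy]

theorem isRunDecomposition (h : IsSegmentIndex L seg) (hL : ∀ l ∈ L, 0 < l) (hsum : L.sum = n)
    {σ : Equiv.Perm (Fin n)} (hσ : σ ∈ maximalPerms seg) :
    IsRunDecomposition (permArray σ) L := by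
  obtain ⟨hσ, hdesc⟩ := mem_maximalPerms.1 hσ
  have hinc := h.increasingSegments hL hsum hσ
  refine ⟨hL, hsum, fun i hi => Or.inl (hinc.incr i hi), fun i hi hc => ?_⟩
  have h1 := segStart_lt hL (show i < i + 1 by omega) hi.le
  have h2 := segStart_lt hL hi le_rfl
  have h3 := segStart_lt_succ hL hi
  rw [segStart_length, hsum] at h2
  have hx := h.eq_of_mem (x := ⟨segStart L (i + 1) - 1, by omega⟩) (i := i)
    (by simp only; omega) (by simp only; omega)
  have hy := h.eq_of_mem (x := ⟨segStart L (i + 1), h2⟩) (i := i + 1) le_rfl h3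
  have hd := hdesc ⟨segStart L (i + 1) - 1, by omega⟩ ⟨segStart L (i + 1), h2⟩
    (by simp only; omega) (by omega)
  have := hc ⟨segStart L (i + 1) - 1, by omega⟩ ⟨segStart L (i + 1), h2⟩ (by simp only; omega)
    (Fin.lt_def.2 (by simp only; omega)) (by simp only; omega)
  exact absurd hd (not_lt.2 this)

/-- If `y` differed from both neighbours, its segment would consist of `y` alone; but it is followed
by another segment, so it has length at least two. -/
theorem eq_of_two_le (h : IsSegmentIndex L seg) (h2 : ∀ l ∈ L.dropLast, 2 ≤ l) (x y z : Fin n)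
    (hxy : (x : ℕ) + 1 = y) (hyz : (y : ℕ) + 1 = z) (hne : seg x ≠ seg y) : seg y = seg z := by
  by_contra hne'
  obtain ⟨-, hx1, hx2⟩ := h x
  obtain ⟨hy0, hy1, hy2⟩ := h y
  obtain ⟨hz0, hz1, hz2⟩ := h z
  have hlt : seg y < seg z :=
    lt_of_le_of_ne (h.monotone (Fin.le_def.2 (by omega))) hne'
  have hlen : segStart L (seg y) + 2 ≤ segStart L (seg y + 1) := by
    rw [segStart_succ hy0]
    have := h2 L[seg y] (by
      rw [← List.getElem_dropLast (i := seg y) (by simp; omega)]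
      exact List.getElem_mem _)
    omega
  have := segStart_mono L (show seg y + 1 ≤ seg z from hlt)
  refine hne (h.eq_of_mem ?_ (by omega))
  omega

end IsSegmentIndex

theorem sorting_lower_bound (T : CompTree (Fin n) (List (Fin n))) (hL : ∀ l ∈ L, 0 < l)
    (hsum : L.sum = n)
    (hT : ∀ A : Fin n → ℕ, Function.Injective A → IncreasingSegments A L → SortsInput T A) :
    ∃ A : Fin n → ℕ, Function.Injective A ∧ IncreasingSegments A L ∧
      runEntropy L * (n : ℝ) - Real.logb 2 (Real.exp 1) * (n : ℝ) ≤ (T.cost A : ℝ) := by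
  obtain ⟨seg, hseg⟩ := exists_isSegmentIndex hsum
  have hne : (sortedPerms seg).Nonempty := ⟨1, mem_sortedPerms.2 fun x y _ hxy => hxy⟩
  obtain ⟨σ, hσ, hc⟩ := exists_logb_card_le_cost T (sortedPerms seg) hne fun σ hσ =>
    hT _ (permArray_injective σ) (hseg.increasingSegments hL hsum hσ)
  have := hseg.runEntropy_mul_le hL hsum
  exact ⟨permArray σ, permArray_injective σ, hseg.increasingSegments hL hsum hσ, by linarith⟩

theorem sorting_lower_bound_maximal (T : CompTree (Fin n) (List (Fin n))) (hL : ∀ l ∈ L, 0 < l)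
    (hsum : L.sum = n) (h2 : ∀ l ∈ L.dropLast, 2 ≤ l)
    (hT : ∀ A : Fin n → ℕ, Function.Injective A → IncreasingSegments A L →
      IsRunDecomposition A L → SortsInput T A) :
    ∃ A : Fin n → ℕ, Function.Injective A ∧ IncreasingSegments A L ∧ IsRunDecomposition A L ∧
      runEntropy L * (n : ℝ) - (Real.logb 2 (Real.exp 1) + 1) * (n : ℝ) ≤ (T.cost A : ℝ) := by
  obtain ⟨seg, hseg⟩ := exists_isSegmentIndex hsum
  have hcard := card_sortedPerms_le hseg.monotone (hseg.eq_of_two_le h2)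
  have hS : 0 < (sortedPerms seg).card :=
    Finset.card_pos.2 ⟨1, mem_sortedPerms.2 fun x y _ hxy => hxy⟩
  -- The counting inequality also shows that arrays with exactly these maximal runs exist: the
  -- identity is sorted on each segment, so neither factor on the right can vanish.
  have hM : 0 < (maximalPerms seg).card := Nat.pos_of_mul_pos_right (hS.trans_le hcard)
  have hinc : ∀ σ ∈ maximalPerms seg, IncreasingSegments (permArray σ) L := fun σ hσ =>
    hseg.increasingSegments hL hsum (mem_maximalPerms.1 hσ).1
  have hrun : ∀ σ ∈ maximalPerms seg, IsRunDecomposition (permArray σ) L := fun σ hσ =>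
    hseg.isRunDecomposition hL hsum hσ
  obtain ⟨σ, hσ, hc⟩ := exists_logb_card_le_cost T (maximalPerms seg) (Finset.card_pos.1 hM)
    fun σ hσ => hT _ (permArray_injective σ) (hinc σ hσ) (hrun σ hσ)
  have hE := hseg.runEntropy_mul_le hL hsum
  have hlog : Real.logb 2 ((sortedPerms seg).card : ℝ) ≤
      Real.logb 2 ((maximalPerms seg).card : ℝ) + n := by
    have hM' : (0 : ℝ) < (maximalPerms seg).card := by exact_mod_cast hM
    have := Real.logb_le_logb_of_le (b := 2) one_lt_two (by exact_mod_cast hS)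
      (show ((sortedPerms seg).card : ℝ) ≤ (maximalPerms seg).card * 2 ^ n by exact_mod_cast hcard)
    rw [Real.logb_mul hM'.ne' (by positivity), Real.logb_pow] at this
    simpa using this
  exact ⟨permArray σ, permArray_injective σ, hinc σ hσ, hrun σ hσ, by linarith⟩

end

theorem theorem2 :
    -- upper bounds for PeekSort
    (∀ {α : Type*} [LinearOrder α] (n : ℕ) (A : Fin n → α) (L : List ℕ)
        (test : ℕ → CompTree (Fin n) ScanStep),
      IsRunDecomposition A L → DetectsRuns A L test →
      (3 ≤ n ∨ 2 ≤ L.length →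
        (((peekSort n test).run A).2 : ℝ) ≤
          runEntropy L * (n : ℝ) + 2 * (n : ℝ) - ((L.length : ℝ) + 2)) ∧
      (2 ≤ n →
        ((peekSort n test).cost A : ℝ) ≤
          runEntropy L * (n : ℝ) + 3 * (n : ℝ) - (2 * (L.length : ℝ) + 3))) ∧
    -- every order of merges has merge cost at least `ℋ n`
    (∀ (L : List ℕ) (t : MergeTree), (∀ l ∈ L, 0 < l) → t.leaves.Perm L →
      runEntropy L * (L.sum : ℝ) ≤ (t.mergeCost : ℝ)) ∧
    -- every comparison-based algorithm needs `ℋ n - O(n)` comparisons in the worst case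
    (∃ C : ℝ, ∀ (n : ℕ) (L : List ℕ) (T : CompTree (Fin n) (List (Fin n))),
      (∀ l ∈ L, 0 < l) → L.sum = n →
      -- on arrays that are cut into sorted segments of lengths `L`
      ((∀ A : Fin n → ℕ, Function.Injective A → IncreasingSegments A L → SortsInput T A) →
        ∃ A : Fin n → ℕ, Function.Injective A ∧ IncreasingSegments A L ∧
          runEntropy L * (n : ℝ) - C * (n : ℝ) ≤ (T.cost A : ℝ)) ∧
      -- also if these segments are the maximal runs, where only the last one may have length `1`
      ((∀ l ∈ L.dropLast, 2 ≤ l) →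
        (∀ A : Fin n → ℕ, Function.Injective A → IncreasingSegments A L →
          IsRunDecomposition A L → SortsInput T A) →
        ∃ A : Fin n → ℕ, Function.Injective A ∧ IncreasingSegments A L ∧
          IsRunDecomposition A L ∧
          runEntropy L * (n : ℝ) - C * (n : ℝ) ≤ (T.cost A : ℝ))) := by
  refine ⟨fun n A L test hA ht => ⟨peekSort_mergeCost_le hA ht, peekSort_cost_le hA ht⟩,
    fun L t hL h => t.runEntropy_mul_le_mergeCost hL h, Real.logb 2 (Real.exp 1) + 1,
    fun n L T hL hsum => ⟨fun hT => ?_, fun h2 hT => sorting_lower_bound_maximal T hL hsum h2 hT⟩⟩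
  obtain ⟨A, h1, h2, h3⟩ := sorting_lower_bound T hL hsum hT
  have : (0 : ℝ) ≤ n := Nat.cast_nonneg n
  exact ⟨A, h1, h2, by linarith⟩
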